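/- Let $d\ge 1$. A dyadic interval is a set $[0,2^{-j}]$ or $(k2^{-j},(k+1)2^{-j}]$ with $j\in\mathbb N=\{0,1,\dots\}$ and $k\in\{1,\dots,2^j-1\}$; a dyadic rectangle of $[0,1]^d$ is a product $I_1\times\dots\times I_d$ of dyadic intervals (possibly of different lengths). For $0<p\le\infty$ let $\|\cdot\|_p$ be the usual Lebesgue (quasi-)norm on $[0,1]^d$, with the essential supremum for $p=\infty$, and $L_p([0,1]^d)$ the set of real measurable functions for which it is finite. Let $r=(r_1,\dots,r_d)\in\mathbb N^d$ and $\sigma\in\prod_{l=1}^d(0,r_l+1)$, and put $$\underline\sigma=\min_{1\le l\le d}\sigma_l,\qquad H(\sigma)=\Big(\frac1d\sum_{l=1}^d\frac1{\sigma_l}\Big)^{-1}.$$ For a partition $m$ of $[0,1]^d$ into dyadic rectangles, $|m|$ is the number of its rectangles and $S_{(m,r)}$ is the space of all functions on $[0,1]^d$ that are polynomial of degree $\le r_l$ in the $l$-th variable, $l=1,\dots,d$, on each rectangle of $m$. For $k\in\mathbb N$ let $\mathcal D_k^\sigma$ be the partition of $[0,1]^d$ into the dyadic rectangles with sidelength $2^{-\lfloor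 k\underline\sigma/\sigma_l\rfloor}$ in the $l$-th direction for every $l$. For $s\in L_p([0,1]^d)$ put $e_k(s)=\inf_{P\in S_{(\mathcal D_k^\sigma,r)}}\|s-P\|_p$ and $$N_{r,\sigma,p,p'}(s)=\Big(\sum_{k\in\mathbb N}\big(2^{k\underline\sigma}e_k(s)\big)^{p'}\Big)^{1/p'}\ (0<p'<\infty),\qquad N_{r,\sigma,p,\infty}(s)=\sup_{k\in\mathbb N}2^{k\underline\sigma}e_k(s),$$ and let $\mathcal S(r,\sigma,p,p',R)=\{s\in L_p([0,1]^d): N_{r,\sigma,p,p'}(s)\le R\}$. Write $(x)_+=\max\{x,0\}$ and $1/\infty=0$. **Theorem.** Let $J\in\mathbb N$, $R>0$, $r\in\mathbb N^d$, $\sigma\in\prod_{l=1}^d(0,r_l+1)$, $0<p<\infty$ and $1\le q\le\infty$ satisfy $$H(\sigma)/d>(1/p-1/q)_+ .$$ Let $p'=\infty$ if $0<p\le1$ or $p\ge q$, and $p'=p$ if $1<p<q$. Let $s\in\mathcal S(r,\sigma,p,p',R)$. Then for every $k\in\mathbb N$ there is a partition $m$ of $[0,1]^d$ into dyadic rectangles,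 each with sidelength at least $2^{-J\underline\sigma/\sigma_l}$ in the $l$-th direction for $l=1,\dots,d$, such that $$|m|\le C_1\,2^{kd}$$ and $$\inf_{t\in S_{(m,r)}}\|s-t\|_q\le C_3\,R\left(2^{-Jd\left(H(\sigma)/d-(1/p-1/q)_+\right)\underline\sigma/H(\sigma)}+2^{-kH(\sigma)}\right),$$ where the positive constant $C_1$ depends only on $d,\sigma,p$ and the positive constant $C_3$ only on $d,r,\sigma,p,q$. -/

import Mathlib

open MeasureTheory Set
open scoped ENNReal

noncomputable section

namespace AnisotropicApprox

/-- The Lebesgue measure on the unit cube `[0,1]^d`. A function on `[0,1]^d` is represented by a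
function on `ℝ^d`, whose values outside the cube never matter. -/
def cubeMeasure (d : ℕ) : Measure (Fin d → ℝ) :=
  (volume : Measure (Fin d → ℝ)).restrict (Icc 0 1)

/-- The dyadic interval of length `2^{-j}` and position `k`: it is `[0, 2^{-j}]` for `k = 0`
and `(k 2^{-j}, (k+1) 2^{-j}]` for `k ≠ 0`. -/
def dyadicInterval (j k : ℕ) : Set ℝ :=
  if k = 0 then Icc 0 (1 / 2 ^ j) else Ioc (k / 2 ^ j) ((k + 1) / 2 ^ j)

/-- A dyadic rectangle of `[0,1]^d`, given by the levels `j_l` (the `l`-th sidelength is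
`2^{-j_l}`) and the positions `k_l ∈ {0, …, 2^{j_l} - 1}` of its sides. -/
@[ext]
structure DyadicRectangle (d : ℕ) where
  level : Fin d → ℕ
  pos : Fin d → ℕ
  pos_lt : ∀ l, pos l < 2 ^ level l

/-- The rectangle `I_1 × … × I_d` as a subset of `ℝ^d`. -/
def DyadicRectangle.toSet {d : ℕ} (K : DyadicRectangle d) : Set (Fin d → ℝ) :=
  Set.univ.pi fun l => dyadicInterval (K.level l) (K.pos l)

/-- The sidelength of a dyadic rectangle in the `l`-th direction. -/
def DyadicRectangle.sidelength {d : ℕ} (K : DyadicRectangle d) (l : Fin d) : ℝ :=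
  1 / 2 ^ K.level l

/-- `m` is a (finite) partition of `[0,1]^d` into dyadic rectangles. -/
def IsDyadicPartition {d : ℕ} (m : Finset (DyadicRectangle d)) : Prop :=
  (∀ K ∈ m, ∀ L ∈ m, K ≠ L → Disjoint K.toSet L.toSet) ∧
    (⋃ K ∈ m, K.toSet) = (Icc 0 1 : Set (Fin d → ℝ))

/-- The functions that are polynomial with degree `≤ r_l` in the `l`-th direction,
`l = 1, …, d`, over each rectangle of the collection `m`. -/
def piecewisePoly {d : ℕ} (r : Fin d → ℕ) (m : Set (DyadicRectangle d)) :
    Set ((Fin d → ℝ) → ℝ) :=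
  {t | ∀ K ∈ m, ∃ P : MvPolynomial (Fin d) ℝ,
    (∀ l, P.degreeOf l ≤ r l) ∧ ∀ x ∈ K.toSet, t x = MvPolynomial.eval x P}

/-- The distance `inf_{t ∈ F} ‖s - t‖_p` in the (quasi-)norm of `L_p([0,1]^d)`. -/
def approxError {d : ℕ} (p : ℝ≥0∞) (F : Set ((Fin d → ℝ) → ℝ)) (s : (Fin d → ℝ) → ℝ) : ℝ≥0∞ :=
  ⨅ t ∈ F, eLpNorm (fun x => s x - t x) p (cubeMeasure d)

/-- The smallest of `σ_1, …, σ_d`. -/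
def sigmaMin {d : ℕ} (σ : Fin d → ℝ) : ℝ := ⨅ l, σ l

/-- The harmonic mean of `σ_1, …, σ_d`. -/
def harmonicMean {d : ℕ} (σ : Fin d → ℝ) : ℝ := (1 / (d : ℝ) * ∑ l, 1 / σ l)⁻¹

/-- The collection `D_j^σ` of the dyadic rectangles with sidelength
`2^{-⌊j σ_min / σ_l⌋}` in the `l`-th direction. -/
def dyadicLevel {d : ℕ} (σ : Fin d → ℝ) (j : ℕ) : Set (DyadicRectangle d) :=
  {K | ∀ l, K.level l = ⌊(j : ℝ) * sigmaMin σ / σ l⌋₊}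

/-- The weighted linear approximation errors `2^{k σ_min} e_{r,σ,p,k}(s)`. -/
def weightedError {d : ℕ} (r : Fin d → ℕ) (σ : Fin d → ℝ) (p : ℝ≥0∞)
    (s : (Fin d → ℝ) → ℝ) (k : ℕ) : ℝ≥0∞ :=
  ENNReal.ofReal ((2 : ℝ) ^ ((k : ℝ) * sigmaMin σ)) *
    approxError p (piecewisePoly r (dyadicLevel σ k)) s

/-- The (quasi-)semi-norm `N_{r,σ,p,p'}(s)`, with values in `[0, ∞]`. -/
def smoothnessNorm {d : ℕ} (r : Fin d → ℕ) (σ : Fin d → ℝ) (p p' : ℝ≥0∞)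
    (s : (Fin d → ℝ) → ℝ) : ℝ≥0∞ :=
  if p' = ∞ then ⨆ k, weightedError r σ p s k
  else (∑' k, weightedError r σ p s k ^ p'.toReal) ^ (1 / p'.toReal)

/-- The class `S(r,σ,p,p',R)` of all `s ∈ L_p([0,1]^d)` with `N_{r,σ,p,p'}(s) ≤ R`. -/
def smoothnessClass {d : ℕ} (r : Fin d → ℕ) (σ : Fin d → ℝ) (p p' : ℝ≥0∞) (R : ℝ) :
    Set ((Fin d → ℝ) → ℝ) :=
  {s | MemLp s p (cubeMeasure d) ∧ smoothnessNorm r σ p p' s ≤ ENNReal.ofReal R}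

/-- The real number `(1/p - 1/q)_+`, with `1/∞ = 0`. -/
def invGap (p q : ℝ≥0∞) : ℝ := max (p⁻¹.toReal - q⁻¹.toReal) 0

end AnisotropicApprox

end

/-!
The proof uses only that `2 ^ (k σ_min) e_k(s) ≤ R` for every `k`, whatever `p'` is. Choose
piecewise polynomials `P k` on the grid `D_k^σ` with `‖s - P k‖_p ≤ 2 R 2 ^ (-k σ_min)`. The grid
`D_k^σ` has about `2 ^ (k β)` cells, where `β = d σ_min / H(σ)`; hence the grid of generation
`⌊k d / β⌋` has about `2 ^ (k d)` cells and the `L_p` error `2 ^ (-k H(σ))` on it. Refinement starts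
at generation `a`, the minimum of this generation and of `J`. For `q ≤ p` the grid of generation `a`
is already good enough (`exists_linear_approx`).

Let `p < q` and `γ = 1 / p - 1 / q`. On a cell, the supremum of a polynomial is controlled by its
normalized `L_p` quasi-norm (`exists_nikolskii_bound`). Consequently the increments `P i - P (i - 1)`
are of order `2 ^ (-i ρ)` in `L_q` with `ρ = σ_min - β γ > 0`, and `‖s - P J‖_q` is of order
`2 ^ (-J ρ)`. For `a < i ≤ J`, mark the cells of generation `i` on which the increment has a large
`L_p` quasi-norm. By Chebyshev's inequality, the threshold can be chosen such that about
`2 ^ (k d) 2 ^ (-δ (i - a))` cells are marked, and by interpolation between `L_p` and `L_∞`, the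
increment without the marked cells is of order `2 ^ (-i ρ) 2 ^ (-k d γ) 2 ^ (δ γ (i - a))` in `L_q`
(`exists_marked_cells`). With `δ γ = ρ / 2` both quantities are summable over `i`, to multiples of
`2 ^ (k d)` and of `2 ^ (-a ρ) 2 ^ (-k d γ)`; if `a < J`, the latter is of order `2 ^ (-k H(σ))`.

Starting from generation `a`, split each cell that contains a marked cell of a later generation
(`exists_adaptive_partition`). A marked cell of generation `i` is responsible for at most `i - a`
splittings, and each splitting creates at most `2 ^ d` cells, so that the final partition has at most
a constant times `2 ^ (k d)` cells. The approximant is `P j` on a final cell of generation `j`: its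
distance to `s` is at most that of `P J` plus the increments without the marked cells.
-/

namespace AnisotropicApprox

/-! ### Dyadic cells -/

/-- The dyadic rectangle of level `L` that contains the point `x` of the unit cube. Outside of the
cube the positions are truncated, and the value is irrelevant. -/
noncomputable def cell {d : ℕ} (L : Fin d → ℕ) (x : Fin d → ℝ) : DyadicRectangle d where
  level := L
  pos l := min (⌈x l * 2 ^ L l⌉₊ - 1) (2 ^ L l - 1)
  pos_lt l := by
    have : 0 < 2 ^ L l := by positivity
    omega

lemma ceil_mul_two_pow_le {x : ℝ} (hx : x ≤ 1) (j : ℕ) : ⌈x * 2 ^ j⌉₊ ≤ 2 ^ j := by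
  rw [Nat.ceil_le]
  push_cast
  nlinarith [show (0 : ℝ) < 2 ^ j by positivity]

lemma cell_pos {d : ℕ} (L : Fin d → ℕ) {x : Fin d → ℝ} (hx : x ∈ Icc (0 : Fin d → ℝ) 1)
    (l : Fin d) : (cell L x).pos l = ⌈x l * 2 ^ L l⌉₊ - 1 := by
  have := ceil_mul_two_pow_le (hx.2 l) (L l)
  simp only [cell]
  omega

lemma mem_dyadicInterval_iff {x : ℝ} (hx : 0 ≤ x) (j k : ℕ) :
    x ∈ dyadicInterval j k ↔ ⌈x * 2 ^ j⌉₊ - 1 = k := by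
  have h2 : (0 : ℝ) < 2 ^ j := by positivity
  unfold dyadicInterval
  split_ifs with hk
  · subst hk
    rw [mem_Icc, le_div_iff₀ h2, tsub_eq_zero_iff_le, Nat.ceil_le]
    simp [hx]
  · rw [mem_Ioc, div_lt_iff₀ h2, le_div_iff₀ h2, ← Nat.lt_ceil]
    have : x * 2 ^ j ≤ (k : ℝ) + 1 ↔ ⌈x * 2 ^ j⌉₊ ≤ k + 1 := by
      rw [Nat.ceil_le]; push_cast; rfl
    rw [this]
    omega

lemma dyadicInterval_subset {j k : ℕ} (hk : k < 2 ^ j) : dyadicInterval j k ⊆ Icc 0 1 := by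
  have h2 : (0 : ℝ) < 2 ^ j := by positivity
  have hk' : (k : ℝ) + 1 ≤ 2 ^ j := by exact_mod_cast hk
  have hle : ((k : ℝ) + 1) / 2 ^ j ≤ 1 := (div_le_one h2).2 hk'
  intro x hx
  unfold dyadicInterval at hx
  split_ifs at hx with h
  · subst h
    refine ⟨hx.1, hx.2.trans ?_⟩
    simpa using hle
  · exact ⟨le_trans (by positivity) hx.1.le, hx.2.trans hle⟩

lemma DyadicRectangle.toSet_subset {d : ℕ} (K : DyadicRectangle d) :
    K.toSet ⊆ Icc (0 : Fin d → ℝ) 1 := fun _ hx =>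
  ⟨fun l => (dyadicInterval_subset (K.pos_lt l) (hx l (mem_univ l))).1,
    fun l => (dyadicInterval_subset (K.pos_lt l) (hx l (mem_univ l))).2⟩

lemma mem_toSet_iff {d : ℕ} (K : DyadicRectangle d) {x : Fin d → ℝ}
    (hx : x ∈ Icc (0 : Fin d → ℝ) 1) : x ∈ K.toSet ↔ cell K.level x = K := by
  rw [DyadicRectangle.ext_iff, funext_iff (f := (cell K.level x).pos)]
  simp only [DyadicRectangle.toSet, mem_univ_pi, cell_pos _ hx,
    fun l => mem_dyadicInterval_iff (hx.1 l) (K.level l) (K.pos l)]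
  exact ⟨fun h => ⟨rfl, h⟩, fun h => h.2⟩

lemma mem_cell {d : ℕ} (L : Fin d → ℕ) {x : Fin d → ℝ} (hx : x ∈ Icc (0 : Fin d → ℝ) 1) :
    x ∈ (cell L x).toSet := (mem_toSet_iff _ hx).2 rfl

lemma mem_cell_iff {d : ℕ} (L : Fin d → ℕ) {x y : Fin d → ℝ}
    (hy : y ∈ Icc (0 : Fin d → ℝ) 1) : y ∈ (cell L x).toSet ↔ cell L y = cell L x :=
  mem_toSet_iff (cell L x) hy

lemma measurableSet_toSet {d : ℕ} (K : DyadicRectangle d) : MeasurableSet K.toSet := by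
  refine MeasurableSet.univ_pi fun l => ?_
  unfold dyadicInterval
  split_ifs
  · exact measurableSet_Icc
  · exact measurableSet_Ioc

lemma ceil_mul_sub_one_div {z : ℝ} (hz : 0 ≤ z) {n : ℕ} (hn : 0 < n) :
    (⌈z * n⌉₊ - 1) / n = ⌈z⌉₊ - 1 := by
  rcases hz.eq_or_lt with rfl | hz
  · simp
  have hn' : (0 : ℝ) < n := by exact_mod_cast hn
  have h1 : ⌈z * n⌉₊ ≤ ⌈z⌉₊ * n := by
    rw [Nat.ceil_le]; push_cast
    exact mul_le_mul_of_nonneg_right (Nat.le_ceil z) hn'.le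
  have h0 : 0 < ⌈z⌉₊ := Nat.ceil_pos.2 hz
  have h2 : (⌈z⌉₊ - 1) * n < ⌈z * n⌉₊ := by
    rw [Nat.lt_ceil]; push_cast
    refine mul_lt_mul_of_pos_right ?_ hn'
    exact Nat.lt_ceil.1 (by omega)
  have h3 : ⌈z⌉₊ - 1 + 1 = ⌈z⌉₊ := by omega
  rw [Nat.div_eq_iff hn]
  have h4 : (⌈z⌉₊ - 1) * n + n = ⌈z⌉₊ * n := by
    conv_rhs => rw [← h3]
    ring
  constructor <;> omega

/-- Coarsening a cell amounts to dividing its positions. -/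
lemma cell_pos_div {d : ℕ} {L' L : Fin d → ℕ} (h : L' ≤ L) {x : Fin d → ℝ}
    (hx : x ∈ Icc (0 : Fin d → ℝ) 1) (l : Fin d) :
    (cell L x).pos l / 2 ^ (L l - L' l) = (cell L' x).pos l := by
  rw [cell_pos _ hx, cell_pos _ hx]
  have hz : 0 ≤ x l * 2 ^ L' l := mul_nonneg (hx.1 l) (by positivity)
  have := ceil_mul_sub_one_div hz (n := 2 ^ (L l - L' l)) (by positivity)
  rw [← this, show x l * 2 ^ L l = x l * 2 ^ L' l * ((2 ^ (L l - L' l) : ℕ) : ℝ) by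
    push_cast
    rw [mul_assoc, ← pow_add, Nat.add_sub_cancel' (h l)]]

lemma cell_eq_of_le {d : ℕ} {L' L : Fin d → ℕ} (h : L' ≤ L) {x y : Fin d → ℝ}
    (hx : x ∈ Icc (0 : Fin d → ℝ) 1) (hy : y ∈ Icc (0 : Fin d → ℝ) 1)
    (hxy : cell L x = cell L y) : cell L' x = cell L' y := by
  refine DyadicRectangle.ext rfl (funext fun l => ?_)
  rw [← cell_pos_div h hx, ← cell_pos_div h hy, hxy]

lemma cell_subset_of_le {d : ℕ} {L' L : Fin d → ℕ} (h : L' ≤ L) {x : Fin d → ℝ}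
    (hx : x ∈ Icc (0 : Fin d → ℝ) 1) : (cell L x).toSet ⊆ (cell L' x).toSet := fun y hy => by
  have hy' := DyadicRectangle.toSet_subset _ hy
  rw [mem_cell_iff _ hy'] at hy ⊢
  exact cell_eq_of_le h hy' hx hy

lemma finite_setOf_level_eq {d : ℕ} (L : Fin d → ℕ) :
    {K : DyadicRectangle d | K.level = L}.Finite := by
  refine Set.Finite.of_finite_image (f := DyadicRectangle.pos)
    ((Finset.finite_toSet (Fintype.piFinset fun l => Finset.range (2 ^ L l))).subset ?_) ?_
  · rintro _ ⟨K, rfl, rfl⟩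
    simpa using K.pos_lt
  · intro K hK K' hK' h
    exact DyadicRectangle.ext (hK.trans hK'.symm) h

/-- The regular grid of all dyadic rectangles of level `L`. -/
noncomputable def gridCells {d : ℕ} (L : Fin d → ℕ) : Finset (DyadicRectangle d) :=
  (finite_setOf_level_eq L).toFinset

@[simp]
lemma mem_gridCells {d : ℕ} {L : Fin d → ℕ} {K : DyadicRectangle d} :
    K ∈ gridCells L ↔ K.level = L := by simp [gridCells]

lemma card_gridCells_le {d : ℕ} (L : Fin d → ℕ) : (gridCells L).card ≤ 2 ^ ∑ l, L l := by
  have : (Fintype.piFinset fun l => Finset.range (2 ^ L l)).card = 2 ^ ∑ l, L l := by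
    simp [Finset.prod_pow_eq_pow_sum]
  rw [← this]
  refine Finset.card_le_card_of_injOn DyadicRectangle.pos ?_ ?_
  · intro K hK
    have hK : K.level = L := by simpa using hK
    subst hK
    simpa using K.pos_lt
  · intro K hK K' hK' h
    have h1 : K.level = L := by simpa using hK
    have h2 : K'.level = L := by simpa using hK'
    exact DyadicRectangle.ext (h1.trans h2.symm) h

lemma disjoint_of_mem_gridCells {d : ℕ} {L : Fin d → ℕ} {K K' : DyadicRectangle d}
    (hK : K ∈ gridCells L) (hK' : K' ∈ gridCells L) (h : K ≠ K') :
    Disjoint K.toSet K'.toSet := by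
  rw [Set.disjoint_left]
  intro x hx hx'
  have hc := K.toSet_subset hx
  rw [mem_toSet_iff _ hc] at hx hx'
  rw [mem_gridCells] at hK hK'
  apply h
  rw [← hx, ← hx', hK, hK']

lemma iUnion_gridCells {d : ℕ} (L : Fin d → ℕ) :
    (⋃ K ∈ gridCells L, K.toSet) = Icc (0 : Fin d → ℝ) 1 := by
  refine Subset.antisymm (iUnion₂_subset fun K _ => K.toSet_subset) fun x hx => ?_
  exact mem_iUnion₂.2 ⟨cell L x, by simp [cell], mem_cell L hx⟩

lemma isDyadicPartition_gridCells {d : ℕ} (L : Fin d → ℕ) : IsDyadicPartition (gridCells L) :=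
  ⟨fun _ hK _ hK' h => disjoint_of_mem_gridCells hK hK' h, iUnion_gridCells L⟩

/-- A grid that is at most twice as fine in every direction splits each cell into at most `2 ^ d`
cells. -/
lemma exists_children {d : ℕ} {L' L : Fin d → ℕ} (h : L' ≤ L) (h1 : ∀ l, L l ≤ L' l + 1)
    (x : Fin d → ℝ) :
    ∃ S : Finset (DyadicRectangle d), S.card ≤ 2 ^ d ∧
      ∀ y ∈ Icc (0 : Fin d → ℝ) 1, cell L' y = cell L' x → cell L y ∈ S := by
  classical
  refine ⟨(gridCells L).filter
    fun K => ∃ y ∈ Icc (0 : Fin d → ℝ) 1, cell L' y = cell L' x ∧ cell L y = K, ?_, ?_⟩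
  · have hcard : (Fintype.piFinset fun _ : Fin d => Finset.range 2).card = 2 ^ d := by simp
    rw [← hcard]
    refine Finset.card_le_card_of_injOn (fun K l => K.pos l % 2) ?_ ?_
    · intro K _
      simpa using fun l => Nat.le_of_lt_succ (Nat.mod_lt (K.pos l) two_pos)
    · intro K hK K' hK' hKK'
      simp only [Finset.coe_filter, mem_ofPred_eq] at hK hK'
      obtain ⟨-, y, hy, hyx, rfl⟩ := hK
      obtain ⟨-, z, hz, hzx, rfl⟩ := hK'
      refine DyadicRectangle.ext rfl (funext fun l => ?_)
      have e1 := cell_pos_div h hy l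
      have e2 := cell_pos_div h hz l
      rw [hyx] at e1
      rw [hzx, ← e1] at e2
      have e3 := congrFun hKK' l
      simp only at e3
      have h2 := h1 l
      rcases Nat.le_one_iff_eq_zero_or_eq_one.1 (show L l - L' l ≤ 1 by omega) with h0 | h0 <;>
      · simp only [h0, pow_zero, pow_one, Nat.div_one] at e2
        omega
  · intro y hy hyx
    simp only [Finset.mem_filter, mem_gridCells]
    exact ⟨rfl, y, hy, hyx, rfl⟩

/-- A choice of rectangles `f x ∋ x` that is constant on each chosen rectangle is a partition. -/
lemma isDyadicPartition_of_selection {d : ℕ} {f : (Fin d → ℝ) → DyadicRectangle d}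
    {m : Finset (DyadicRectangle d)} (hmem : ∀ x ∈ Icc (0 : Fin d → ℝ) 1, x ∈ (f x).toSet)
    (hconst : ∀ x ∈ Icc (0 : Fin d → ℝ) 1, ∀ y ∈ (f x).toSet, f y = f x)
    (hm : ∀ K, K ∈ m ↔ ∃ x ∈ Icc (0 : Fin d → ℝ) 1, f x = K) : IsDyadicPartition m := by
  constructor
  · intro K hK K' hK' hne
    obtain ⟨x, hx, rfl⟩ := (hm _).1 hK
    obtain ⟨y, hy, rfl⟩ := (hm _).1 hK'
    refine Set.disjoint_left.2 fun z hz hz' => hne ?_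
    rw [← hconst x hx z hz, ← hconst y hy z hz']
  · refine Subset.antisymm (iUnion₂_subset fun K _ => K.toSet_subset) fun x hx => ?_
    exact mem_iUnion₂.2 ⟨f x, (hm _).2 ⟨x, hx, rfl⟩, hmem x hx⟩

/-! ### Adaptive refinement of nested partitions -/

/-- Let `c 0, c 1, …` be nested partitions of `X` (`c j x` is the cell of `x`) in which every cell
has at most `B` children, and let `Λ i` be a finite set of marked cells of generation `i`. Starting
from generation `a`, split a cell as long as it contains a marked cell of a later generation `≤ J`.
In the resulting partition the cell of `x` is `c (τ x) x`, and every marked cell is responsible for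
the splitting of at most one cell in each generation. -/
theorem exists_adaptive_stopping {X β : Type*} (c : ℕ → X → β)
    (hc : ∀ i j x y, i ≤ j → c j x = c j y → c i x = c i y) (B a J : ℕ) (haJ : a ≤ J)
    (D : Finset β) (hD : ∀ x, c a x ∈ D)
    (hB : ∀ j x, ∃ S : Finset β, S.card ≤ B ∧ ∀ y, c j y = c j x → c (j + 1) y ∈ S)
    (Λ : ℕ → Finset β) :
    ∃ τ : X → ℕ, (∀ x, a ≤ τ x ∧ τ x ≤ J) ∧
      (∀ x y, c (τ x) y = c (τ x) x → τ y = τ x) ∧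
      (∀ x i, τ x < i → i ≤ J → c i x ∉ Λ i) ∧
      ∃ m : Finset β, (∀ b, b ∈ m ↔ ∃ x, c (τ x) x = b) ∧
        m.card ≤ D.card + B * ∑ i ∈ Finset.Ioc a J, (i - a) * (Λ i).card := by
  classical
  let split : ℕ → X → Prop := fun j x => ∃ y i, c j y = c j x ∧ j < i ∧ i ≤ J ∧ c i y ∈ Λ i
  have hsplit : ∀ j x y, c j y = c j x → (split j y ↔ split j x) := by
    intro j x y h
    simp only [split, h]
  have hex : ∀ x, ∃ j, a ≤ j ∧ ¬ split j x := fun x =>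
    ⟨J, haJ, fun ⟨_, i, _, h1, h2, _⟩ => absurd h1 (by omega)⟩
  let τ : X → ℕ := fun x => Nat.find (hex x)
  have hτ : ∀ x, a ≤ τ x ∧ ¬ split (τ x) x := fun x => Nat.find_spec (hex x)
  have hτmin : ∀ x j, a ≤ j → j < τ x → split j x := fun x j h1 h2 => by
    by_contra h3
    exact Nat.find_min (hex x) h2 ⟨h1, h3⟩
  have hτJ : ∀ x, τ x ≤ J := fun x => Nat.find_min' (hex x)
    ⟨haJ, fun ⟨_, i, _, h1, h2, _⟩ => absurd h1 (by omega)⟩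
  choose S hScard hS using hB
  let child : ℕ → ℕ → β → Finset β := fun i j K =>
    if h : ∃ y, c i y = K then S j h.choose else ∅
  let M : Finset β := D ∪ (Finset.Ioc a J).biUnion fun i => (Λ i).biUnion fun K =>
    (Finset.Ico a i).biUnion fun j => child i j K
  have hM : ∀ x, c (τ x) x ∈ M := by
    intro x
    rcases (hτ x).1.eq_or_lt with h | h
    · rw [← h]
      exact Finset.mem_union_left _ (hD x)
    · obtain ⟨y, i, hyx, hji, hiJ, hy⟩ := hτmin x (τ x - 1) (by omega) (by omega)
      refine Finset.mem_union_right _ ?_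
      simp only [Finset.mem_biUnion, Finset.mem_Ioc, Finset.mem_Ico]
      refine ⟨i, ⟨by omega, hiJ⟩, c i y, hy, τ x - 1, ⟨by omega, hji⟩, ?_⟩
      have hex' : ∃ z, c i z = c i y := ⟨y, rfl⟩
      simp only [child, dif_pos hex']
      have h1 : c (τ x - 1) hex'.choose = c (τ x - 1) y := hc _ _ _ _ hji.le hex'.choose_spec
      have := hS (τ x - 1) hex'.choose x (by rw [h1, hyx])
      rwa [show τ x - 1 + 1 = τ x by omega] at this
  refine ⟨τ, fun x => ⟨(hτ x).1, hτJ x⟩, ?_, ?_, M.filter fun b => ∃ x, c (τ x) x = b, ?_, ?_⟩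
  · intro x y h
    have h' : ∀ j ≤ τ x, (split j y ↔ split j x) := fun j hj => hsplit j x y (hc j _ y x hj h)
    refine (Nat.find_eq_iff (hex y)).2 ⟨⟨(hτ x).1, ?_⟩, fun j hj hcon => ?_⟩
    · rw [h' _ le_rfl]
      exact (hτ x).2
    · exact hcon.2 ((h' j hj.le).2 (hτmin x j hcon.1 hj))
  · intro x i h1 h2 h3
    exact (hτ x).2 ⟨x, i, rfl, h1, h2, h3⟩
  · intro b
    simp only [Finset.mem_filter, and_iff_right_iff_imp]
    rintro ⟨x, rfl⟩
    exact hM x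
  · refine (Finset.card_filter_le _ _).trans ((Finset.card_union_le _ _).trans ?_)
    refine Nat.add_le_add_left ?_ _
    have hchild : ∀ i j K, (child i j K).card ≤ B := by
      intro i j K
      simp only [child]
      split_ifs
      · exact hScard _ _
      · simp
    rw [Finset.mul_sum]
    refine Finset.card_biUnion_le.trans (Finset.sum_le_sum fun i _ => ?_)
    refine (Finset.card_biUnion_le_card_mul _ _ ((i - a) * B) fun K _ => ?_).trans
      (le_of_eq (by ring))
    simpa using Finset.card_biUnion_le_card_mul (Finset.Ico a i) _ B fun j _ => hchild i j K

/-! ### A Nikolskii inequality for polynomials on dyadic rectangles -/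

/-- The polynomial function `u ↦ ∑ ν, c ν * u ^ ν` of degree at most `r l` in the `l`-th
variable. -/
def coeffPoly {d : ℕ} (r : Fin d → ℕ) (c : ((l : Fin d) → Fin (r l + 1)) → ℝ)
    (u : Fin d → ℝ) : ℝ :=
  ∑ ν, c ν * ∏ l, u l ^ (ν l : ℕ)

lemma continuous_coeffPoly {d : ℕ} (r : Fin d → ℕ) :
    Continuous (Function.uncurry (coeffPoly r)) := by
  unfold coeffPoly Function.uncurry
  fun_prop

lemma coeffPoly_smul {d : ℕ} (r : Fin d → ℕ) (a : ℝ) (c : ((l : Fin d) → Fin (r l + 1)) → ℝ)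
    (u : Fin d → ℝ) : coeffPoly r (a • c) u = a * coeffPoly r c u := by
  simp [coeffPoly, Finset.mul_sum, mul_assoc]

lemma abs_coeffPoly_le {d : ℕ} (r : Fin d → ℕ) (c : ((l : Fin d) → Fin (r l + 1)) → ℝ)
    {u : Fin d → ℝ} (hu : u ∈ Icc (0 : Fin d → ℝ) 1) :
    |coeffPoly r c u| ≤ Fintype.card ((l : Fin d) → Fin (r l + 1)) * ‖c‖ := by
  unfold coeffPoly
  refine (Finset.abs_sum_le_sum_abs _ _).trans ?_
  have : ∀ ν ∈ (Finset.univ : Finset ((l : Fin d) → Fin (r l + 1))),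
      |c ν * ∏ l, u l ^ (ν l : ℕ)| ≤ ‖c‖ := by
    intro ν _
    rw [abs_mul]
    have h1 : |c ν| ≤ ‖c‖ := norm_le_pi_norm c ν
    have h2 : |∏ l, u l ^ (ν l : ℕ)| ≤ 1 := by
      rw [abs_of_nonneg (Finset.prod_nonneg fun l _ => pow_nonneg (hu.1 l) _)]
      exact Finset.prod_le_one (fun l _ => pow_nonneg (hu.1 l) _)
        fun l _ => pow_le_one₀ (hu.1 l) (hu.2 l)
    calc |c ν| * |∏ l, u l ^ (ν l : ℕ)| ≤ ‖c‖ * 1 := by gcongr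
      _ = ‖c‖ := mul_one _
  simpa using Finset.sum_le_card_nsmul _ _ _ this

lemma coeffPoly_eq_eval {d : ℕ} (r : Fin d → ℕ) (c : ((l : Fin d) → Fin (r l + 1)) → ℝ)
    (u : Fin d → ℝ) : coeffPoly r c u = MvPolynomial.eval u
      (∑ ν, MvPolynomial.monomial (Finsupp.equivFunOnFinite.symm fun l => (ν l : ℕ)) (c ν)) := by
  simp [coeffPoly, MvPolynomial.eval_monomial, Finsupp.prod_fintype]

lemma ae_cube_eq (d : ℕ) :
    (Set.univ.pi fun _ : Fin d => Ioo (0 : ℝ) 1) =ᵐ[volume] Icc (0 : Fin d → ℝ) 1 :=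
  Measure.univ_pi_Ioo_ae_eq_Icc (μ := fun _ : Fin d => (volume : Measure ℝ))

lemma eq_zero_of_coeffPoly_ae {d : ℕ} (r : Fin d → ℕ) (c : ((l : Fin d) → Fin (r l + 1)) → ℝ)
    (h : coeffPoly r c =ᵐ[volume.restrict (Icc (0 : Fin d → ℝ) 1)] 0) : c = 0 := by
  rw [← Measure.restrict_congr_set (ae_cube_eq d)] at h
  have hc : Continuous (coeffPoly r c) :=
    (continuous_coeffPoly r).comp (Continuous.prodMk_right c)
  have hopen : IsOpen (Set.univ.pi fun _ : Fin d => Ioo (0 : ℝ) 1) :=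
    isOpen_set_pi finite_univ fun _ _ => isOpen_Ioo
  have hEq := Measure.eqOn_open_of_ae_eq h hopen hc.continuousOn continuousOn_const
  have hpoly : (∑ ν, MvPolynomial.monomial (Finsupp.equivFunOnFinite.symm fun l => (ν l : ℕ)) (c ν)
      : MvPolynomial (Fin d) ℝ) = 0 := by
    refine MvPolynomial.funext_set (fun _ => Ioo (0 : ℝ) 1)
      (fun _ => Ioo_infinite zero_lt_one) ?_
    intro x hx
    rw [← coeffPoly_eq_eval, map_zero]
    exact hEq hx
  funext ν
  have h2 := congrArg
    (MvPolynomial.coeff (Finsupp.equivFunOnFinite.symm fun l => (ν l : ℕ))) hpoly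
  rw [MvPolynomial.coeff_sum, Finset.sum_eq_single ν] at h2
  · simpa using h2
  · intro ν' _ hne
    rw [MvPolynomial.coeff_monomial, if_neg]
    intro h3
    apply hne
    funext l
    have := congrFun (Finsupp.equivFunOnFinite.symm.injective h3) l
    exact Fin.ext this
  · simp

/-- By compactness of the unit sphere in the space of coefficients, the supremum of a polynomial on
the unit cube is controlled by its `L_p` quasi-norm. -/
lemma exists_coeffPoly_bound {d : ℕ} (r : Fin d → ℕ) {p : ℝ} (hp : 0 < p) :
    ∃ C : ℝ, 0 < C ∧ ∀ c, ∀ u ∈ Icc (0 : Fin d → ℝ) 1,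
      ‖coeffPoly r c u‖ₑ ^ p ≤
        ENNReal.ofReal C * ∫⁻ y in Icc (0 : Fin d → ℝ) 1, ‖coeffPoly r c y‖ₑ ^ p := by
  let F : (((l : Fin d) → Fin (r l + 1)) → ℝ) → ℝ := fun c =>
    ∫ y in Icc (0 : Fin d → ℝ) 1, |coeffPoly r c y| ^ p
  have hcont : Continuous (Function.uncurry fun (c : ((l : Fin d) → Fin (r l + 1)) → ℝ)
      (y : Fin d → ℝ) => |coeffPoly r c y| ^ p) :=
    (continuous_coeffPoly r).abs.rpow_const fun _ => Or.inr hp.le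
  have hF : Continuous F := continuous_parametric_integral_of_continuous hcont isCompact_Icc
  have hconty : ∀ c, Continuous fun y => |coeffPoly r c y| ^ p := fun c =>
    hcont.comp (Continuous.prodMk_right c)
  have hint : ∀ c, IntegrableOn (fun y => |coeffPoly r c y| ^ p) (Icc (0 : Fin d → ℝ) 1) :=
    fun c => (hconty c).continuousOn.integrableOn_compact isCompact_Icc
  have hnonneg : ∀ c y, 0 ≤ |coeffPoly r c y| ^ p := fun c y => by positivity
  have hpos : ∀ c, c ≠ 0 → 0 < F c := by
    intro c hc
    refine lt_of_le_of_ne (integral_nonneg (hnonneg c)) fun h0 => hc ?_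
    have := (integral_eq_zero_iff_of_nonneg (hnonneg c) (hint c)).1 h0.symm
    refine eq_zero_of_coeffPoly_ae r c ?_
    filter_upwards [this] with y hy
    simpa [Real.rpow_eq_zero_iff_of_nonneg, hp.ne'] using hy
  have hlint : ∀ c, ∫⁻ y in Icc (0 : Fin d → ℝ) 1, ‖coeffPoly r c y‖ₑ ^ p
      = ENNReal.ofReal (F c) := by
    intro c
    rw [ofReal_integral_eq_lintegral_ofReal (hint c) (ae_of_all _ (hnonneg c))]
    refine lintegral_congr fun y => ?_
    rw [Real.enorm_eq_ofReal_abs, ENNReal.ofReal_rpow_of_nonneg (abs_nonneg _) hp.le]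
  have hne : (Metric.sphere (0 : ((l : Fin d) → Fin (r l + 1)) → ℝ) 1).Nonempty :=
    NormedSpace.sphere_nonempty.2 zero_le_one
  obtain ⟨c₀, hc₀, hmin⟩ := (isCompact_sphere (0 : ((l : Fin d) → Fin (r l + 1)) → ℝ)
    1).exists_isMinOn hne hF.continuousOn
  have hc₀' : c₀ ≠ 0 := by
    rintro rfl
    simp at hc₀
  have hF0 := hpos c₀ hc₀'
  set M : ℝ := (Fintype.card ((l : Fin d) → Fin (r l + 1)) : ℝ) with hM
  have hM0 : 0 < M := by
    rw [hM]; exact_mod_cast Fintype.card_pos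
  refine ⟨M ^ p / F c₀, by positivity, fun c u hu => ?_⟩
  rw [hlint, Real.enorm_eq_ofReal_abs, ENNReal.ofReal_rpow_of_nonneg (abs_nonneg _) hp.le,
    ← ENNReal.ofReal_mul (by positivity)]
  refine ENNReal.ofReal_le_ofReal ?_
  by_cases hc : c = 0
  · subst hc
    have : coeffPoly r 0 u = 0 := by simp [coeffPoly]
    rw [this, abs_zero, Real.zero_rpow hp.ne']
    exact mul_nonneg (by positivity) (integral_nonneg (hnonneg 0))
  have hn : 0 < ‖c‖ := norm_pos_iff.2 hc
  -- `F` is homogeneous of degree `p`, so its minimum on the sphere bounds it everywhere.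
  have hhom : F c = ‖c‖ ^ p * F (‖c‖⁻¹ • c) := by
    simp only [F]
    rw [← integral_const_mul]
    refine integral_congr_ae (ae_of_all _ fun y => ?_)
    simp only [coeffPoly_smul]
    rw [abs_mul, abs_of_pos (inv_pos.2 hn), Real.mul_rpow (by positivity) (abs_nonneg _),
      ← mul_assoc, ← Real.mul_rpow hn.le (by positivity), mul_inv_cancel₀ hn.ne', Real.one_rpow,
      one_mul]
  have hge : F c₀ ≤ F (‖c‖⁻¹ • c) := hmin (by
    rw [mem_sphere_zero_iff_norm, norm_smul, norm_inv, norm_norm, inv_mul_cancel₀ hn.ne'])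
  calc |coeffPoly r c u| ^ p ≤ (M * ‖c‖) ^ p :=
        Real.rpow_le_rpow (abs_nonneg _) (abs_coeffPoly_le r c hu) hp.le
    _ = M ^ p * ‖c‖ ^ p := Real.mul_rpow hM0.le hn.le
    _ = M ^ p / F c₀ * (‖c‖ ^ p * F c₀) := by field_simp
    _ ≤ M ^ p / F c₀ * F c := by
        rw [hhom]
        gcongr

/-- The affine map of the unit cube onto (the closure of) the rectangle `K`. -/
noncomputable def DyadicRectangle.chart {d : ℕ} (K : DyadicRectangle d) (u : Fin d → ℝ) :
    Fin d → ℝ :=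
  fun l => (u l + K.pos l) / 2 ^ K.level l

lemma exists_coeffPoly_chart {d : ℕ} {r : Fin d → ℕ} (K : DyadicRectangle d)
    {P : MvPolynomial (Fin d) ℝ} (hP : ∀ l, P.degreeOf l ≤ r l) :
    ∃ c, ∀ u, MvPolynomial.eval (K.chart u) P = coeffPoly r c u := by
  let V : Submodule ℝ ((Fin d → ℝ) → ℝ) := Submodule.span ℝ
    (Set.range fun (ν : (l : Fin d) → Fin (r l + 1)) (u : Fin d → ℝ) => ∏ l, u l ^ (ν l : ℕ))
  have hV : (fun u => MvPolynomial.eval (K.chart u) P) ∈ V := by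
    have hsum : (fun u => MvPolynomial.eval (K.chart u) P) =
        ∑ ν ∈ P.support, MvPolynomial.coeff ν P • fun u : Fin d → ℝ =>
          ∏ l, K.chart u l ^ ν l := by
      funext u
      simp [MvPolynomial.eval_eq']
    rw [hsum]
    refine V.sum_mem fun ν hν => V.smul_mem _ ?_
    have hdeg : ∀ l, ν l ≤ r l := fun l => MvPolynomial.degreeOf_le_iff.1 (hP l) ν hν
    have hexp : (fun u : Fin d → ℝ => ∏ l, K.chart u l ^ ν l) =
        ∑ κ ∈ Fintype.piFinset fun l => Finset.range (ν l + 1),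
          (∏ l, (K.pos l : ℝ) ^ (ν l - κ l) * ((ν l).choose (κ l) : ℝ) / (2 ^ K.level l) ^ ν l) •
            fun u : Fin d → ℝ => ∏ l, u l ^ κ l := by
      funext u
      simp only [DyadicRectangle.chart, div_pow, add_pow, Finset.sum_apply, Pi.smul_apply,
        smul_eq_mul, Finset.sum_div]
      rw [Finset.prod_univ_sum]
      refine Finset.sum_congr rfl fun κ _ => ?_
      rw [← Finset.prod_mul_distrib]
      refine Finset.prod_congr rfl fun l _ => ?_
      ring
    rw [hexp]
    refine V.sum_mem fun κ hκ => V.smul_mem _ (Submodule.subset_span ?_)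
    rw [Fintype.mem_piFinset] at hκ
    refine ⟨fun l => ⟨κ l, ?_⟩, rfl⟩
    have := Finset.mem_range.1 (hκ l)
    have := hdeg l
    omega
  obtain ⟨c, hc⟩ := (Submodule.mem_span_range_iff_exists_fun ℝ).1 hV
  refine ⟨c, fun u => ?_⟩
  have := congrFun hc u
  simp only [Finset.sum_apply, Pi.smul_apply, smul_eq_mul] at this
  exact this.symm

lemma exists_chart_eq {d : ℕ} (K : DyadicRectangle d) {x : Fin d → ℝ} (hx : x ∈ K.toSet) :
    ∃ u ∈ Icc (0 : Fin d → ℝ) 1, K.chart u = x := by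
  have key : ∀ l, 0 ≤ x l * 2 ^ K.level l - K.pos l ∧ x l * 2 ^ K.level l - K.pos l ≤ 1 := by
    intro l
    have h2 : (0 : ℝ) < 2 ^ K.level l := by positivity
    have h : x l ∈ dyadicInterval (K.level l) (K.pos l) := hx l (mem_univ l)
    unfold dyadicInterval at h
    split_ifs at h with h0
    · rw [mem_Icc, le_div_iff₀ h2] at h
      rw [h0]
      have := mul_nonneg h.1 h2.le
      simp only [Nat.cast_zero, sub_zero]
      exact ⟨this, h.2⟩
    · rw [mem_Ioc, le_div_iff₀ h2, div_lt_iff₀ h2] at h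
      constructor <;> linarith [h.1, h.2]
  refine ⟨fun l => x l * 2 ^ K.level l - K.pos l, ⟨fun l => (key l).1, fun l => (key l).2⟩, ?_⟩
  funext l
  simp [DyadicRectangle.chart]

lemma chart_mem {d : ℕ} (K : DyadicRectangle d) {u : Fin d → ℝ}
    (hu : u ∈ Set.univ.pi fun _ : Fin d => Ioo (0 : ℝ) 1) : K.chart u ∈ K.toSet := by
  intro l _
  have h2 : (0 : ℝ) < 2 ^ K.level l := by positivity
  have h : u l ∈ Ioo (0 : ℝ) 1 := hu l (mem_univ l)
  simp only [DyadicRectangle.chart]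
  unfold dyadicInterval
  split_ifs with h0
  · rw [h0, mem_Icc]
    simp only [Nat.cast_zero, add_zero]
    exact ⟨div_nonneg h.1.le h2.le, by gcongr; exact h.2.le⟩
  · rw [mem_Ioc]
    constructor
    · exact div_lt_div_of_pos_right (by linarith [h.1]) h2
    · exact div_le_div_of_nonneg_right (by linarith [h.2]) h2.le

lemma lintegral_chart_le {d : ℕ} (K : DyadicRectangle d) {g : (Fin d → ℝ) → ℝ≥0∞}
    (hg : Measurable g) :
    ∫⁻ u in Icc (0 : Fin d → ℝ) 1, g (K.chart u) ≤
      ENNReal.ofReal (2 ^ ∑ l, K.level l) * ∫⁻ x in K.toSet, g x := by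
  let D : Fin d → ℝ := fun l => 1 / 2 ^ K.level l
  let b : Fin d → ℝ := fun l => K.pos l / 2 ^ K.level l
  have hdet : (Matrix.diagonal D).det = (2 ^ ∑ l, K.level l)⁻¹ := by
    simp [D, Matrix.det_diagonal, Finset.prod_pow_eq_pow_sum]
  have h2 : (0 : ℝ) < 2 ^ ∑ l, K.level l := by positivity
  have hvol := Real.smul_map_diagonal_volume_pi (D := D) (by rw [hdet]; positivity)
  have hchart : ∀ u, K.chart u = Matrix.toLin' (Matrix.diagonal D) u + b := by
    intro u
    funext l
    simp [DyadicRectangle.chart, Matrix.mulVec_diagonal, D, b]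
    ring
  have hm : Measurable (Matrix.toLin' (Matrix.diagonal D)) :=
    (LinearMap.continuous_of_finiteDimensional _).measurable
  have hind : Measurable (K.toSet.indicator g) := hg.indicator (measurableSet_toSet K)
  have e1 : ∫⁻ x in K.toSet, g x =
      ENNReal.ofReal (2 ^ ∑ l, K.level l)⁻¹ * ∫⁻ u, K.toSet.indicator g (K.chart u) := by
    rw [← lintegral_indicator (measurableSet_toSet K),
      ← lintegral_add_right_eq_self (K.toSet.indicator g) b]
    conv_lhs => rw [← hvol]
    rw [lintegral_smul_measure, hdet, abs_of_pos (inv_pos.2 h2),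
      lintegral_map (f := fun x => K.toSet.indicator g (x + b))
        (hind.comp (measurable_add_const b)) hm]
    simp only [hchart, smul_eq_mul]
  rw [e1, ← mul_assoc, ← ENNReal.ofReal_mul h2.le, mul_inv_cancel₀ h2.ne', ENNReal.ofReal_one,
    one_mul, ← setLIntegral_congr (ae_cube_eq d)]
  refine le_trans (le_of_eq ?_)
    (setLIntegral_le_lintegral (Set.univ.pi fun _ : Fin d => Ioo (0 : ℝ) 1) _)
  refine setLIntegral_congr_fun (MeasurableSet.univ_pi fun _ => measurableSet_Ioo) ?_
  intro u hu
  simp [indicator_of_mem (chart_mem K hu)]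

/-- On a dyadic rectangle, the supremum of a polynomial is at most a constant times the
normalized `L_p` quasi-norm, with a constant that does not depend on the rectangle. -/
theorem exists_nikolskii_bound {d : ℕ} (r : Fin d → ℕ) {p : ℝ} (hp : 0 < p) :
    ∃ C : ℝ, 0 < C ∧ ∀ (K : DyadicRectangle d) (P : MvPolynomial (Fin d) ℝ),
      (∀ l, P.degreeOf l ≤ r l) → ∀ x ∈ K.toSet,
        ‖MvPolynomial.eval x P‖ₑ ^ p ≤ ENNReal.ofReal (C * 2 ^ ∑ l, K.level l) *
          ∫⁻ y in K.toSet, ‖MvPolynomial.eval y P‖ₑ ^ p := by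
  obtain ⟨C, hC, h⟩ := exists_coeffPoly_bound r hp
  refine ⟨C, hC, fun K P hP x hx => ?_⟩
  obtain ⟨c, hc⟩ := exists_coeffPoly_chart K hP
  obtain ⟨u, hu, rfl⟩ := exists_chart_eq K hx
  rw [hc, ENNReal.ofReal_mul hC.le, mul_assoc]
  refine (h c u hu).trans (mul_le_mul_right ?_ _)
  simp only [← hc]
  refine lintegral_chart_le K (g := fun y => ‖MvPolynomial.eval y P‖ₑ ^ p) ?_
  exact (MvPolynomial.continuous_eval P).measurable.enorm.pow_const p

/-- A monotone sequence of grids, each at most twice as fine as the previous one in every direction,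
and marked cells `Λ i` of the `i`-th grid give a partition of the cube into cells of the grids of
generations `a, …, J`: the cell of `x` has generation `τ x`, and no cell of a later generation
`≤ J` that contains `x` is marked. -/
lemma exists_adaptive_partition {d : ℕ} {L : ℕ → Fin d → ℕ} (hL : Monotone L)
    (hL1 : ∀ j l, L (j + 1) l ≤ L j l + 1) {a J : ℕ} (haJ : a ≤ J)
    (Λ : ℕ → Finset (DyadicRectangle d)) :
    ∃ (τ : (Fin d → ℝ) → ℕ) (m : Finset (DyadicRectangle d)), IsDyadicPartition m ∧
      (∀ x ∈ Icc (0 : Fin d → ℝ) 1, a ≤ τ x ∧ τ x ≤ J) ∧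
      (∀ x ∈ Icc (0 : Fin d → ℝ) 1, ∀ i, τ x < i → i ≤ J → cell (L i) x ∉ Λ i) ∧
      (∀ K ∈ m, ∃ x ∈ Icc (0 : Fin d → ℝ) 1, K = cell (L (τ x)) x ∧ ∀ y ∈ K.toSet, τ y = τ x) ∧
      m.card ≤ (gridCells (L a)).card +
        2 ^ d * ∑ i ∈ Finset.Ioc a J, (i - a) * (Λ i).card := by
  obtain ⟨τ, h1, h2, h3, m, hm, hcard⟩ := exists_adaptive_stopping
    (X := Icc (0 : Fin d → ℝ) 1) (fun j x => cell (L j) x.1)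
    (fun i j x y hij h => cell_eq_of_le (hL hij) x.2 y.2 h) (2 ^ d) a J haJ
    (gridCells (L a)) (fun x => by simp [cell])
    (fun j x => by
      obtain ⟨S, hS, hS'⟩ := exists_children (hL (Nat.le_succ j)) (hL1 j) x.1
      exact ⟨S, hS, fun y hy => hS' y.1 y.2 hy⟩) Λ
  classical
  let τ' : (Fin d → ℝ) → ℕ := fun x =>
    if h : x ∈ Icc (0 : Fin d → ℝ) 1 then τ ⟨x, h⟩ else 0
  have hτ' : ∀ x (hx : x ∈ Icc (0 : Fin d → ℝ) 1), τ' x = τ ⟨x, hx⟩ := fun x hx => dif_pos hx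
  have hconst : ∀ x ∈ Icc (0 : Fin d → ℝ) 1, ∀ y ∈ (cell (L (τ' x)) x).toSet, τ' y = τ' x := by
    intro x hx y hy
    have hyc := DyadicRectangle.toSet_subset _ hy
    rw [mem_cell_iff _ hyc, hτ' x hx] at hy
    rw [hτ' x hx, hτ' y hyc]
    exact h2 ⟨x, hx⟩ ⟨y, hyc⟩ hy
  refine ⟨τ', m, isDyadicPartition_of_selection (f := fun x => cell (L (τ' x)) x)
    (fun x hx => mem_cell _ hx) ?_ ?_, ?_, ?_, ?_, hcard⟩
  · intro x hx y hy
    have hyc := DyadicRectangle.toSet_subset _ hy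
    simp only [hconst x hx y hy]
    exact (mem_cell_iff _ hyc).1 hy
  · intro K
    rw [hm]
    constructor
    · rintro ⟨x, rfl⟩
      exact ⟨x.1, x.2, by simp only [hτ' x.1 x.2]⟩
    · rintro ⟨x, hx, rfl⟩
      exact ⟨⟨x, hx⟩, by simp only [hτ' x hx]⟩
  · intro x hx
    rw [hτ' x hx]
    exact h1 ⟨x, hx⟩
  · intro x hx i hi hiJ
    rw [hτ' x hx] at hi
    exact h3 ⟨x, hx⟩ i hi hiJ
  · intro K hK
    obtain ⟨x, rfl⟩ := (hm K).1 hK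
    have he : cell (L (τ x)) x.1 = cell (L (τ' x.1)) x.1 := by simp only [hτ' x.1 x.2]
    refine ⟨x.1, x.2, he, fun y hy => hconst x.1 x.2 y ?_⟩
    rwa [← he]

/-! ### Norms of piecewise polynomial functions -/

lemma aestronglyMeasurable_of_gridCells {d : ℕ} (L : Fin d → ℕ) {f : (Fin d → ℝ) → ℝ}
    (hf : ∀ K ∈ gridCells L, ∃ g : (Fin d → ℝ) → ℝ, Measurable g ∧ ∀ x ∈ K.toSet, f x = g x) :
    AEStronglyMeasurable f (cubeMeasure d) := by
  have hU : (Icc (0 : Fin d → ℝ) 1) = ⋃ K : gridCells L, K.1.toSet := by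
    rw [← iUnion_gridCells L, iUnion_subtype]
  rw [cubeMeasure, hU, aestronglyMeasurable_iUnion_iff]
  rintro ⟨K, hK⟩
  obtain ⟨g, hg, hfg⟩ := hf K hK
  refine hg.aestronglyMeasurable.congr ?_
  filter_upwards [ae_restrict_mem (measurableSet_toSet K)] with x hx
  exact (hfg x hx).symm

lemma aestronglyMeasurable_of_mem_piecewisePoly {d : ℕ} {r : Fin d → ℕ} {L : Fin d → ℕ}
    {f : (Fin d → ℝ) → ℝ} (hf : f ∈ piecewisePoly r (gridCells L : Set (DyadicRectangle d))) :
    AEStronglyMeasurable f (cubeMeasure d) := by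
  refine aestronglyMeasurable_of_gridCells L fun K hK => ?_
  obtain ⟨P, -, hP⟩ := hf K hK
  exact ⟨_, (MvPolynomial.continuous_eval P).measurable, hP⟩

lemma lintegral_cubeMeasure_eq_sum {d : ℕ} (L : Fin d → ℕ) (f : (Fin d → ℝ) → ℝ≥0∞) :
    ∫⁻ x, f x ∂cubeMeasure d = ∑ K ∈ gridCells L, ∫⁻ x in K.toSet, f x := by
  rw [cubeMeasure, ← iUnion_gridCells L]
  refine lintegral_biUnion_finset ?_ (fun K _ => measurableSet_toSet K) f
  exact fun K hK K' hK' h => disjoint_of_mem_gridCells hK hK' h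

lemma sub_mem_piecewisePoly {d : ℕ} {r : Fin d → ℕ} {m : Set (DyadicRectangle d)}
    {f g : (Fin d → ℝ) → ℝ} (hf : f ∈ piecewisePoly r m) (hg : g ∈ piecewisePoly r m) :
    (fun x => f x - g x) ∈ piecewisePoly r m := by
  intro K hK
  obtain ⟨P, hP, hfP⟩ := hf K hK
  obtain ⟨Q, hQ, hgQ⟩ := hg K hK
  refine ⟨P - Q, fun l => (MvPolynomial.degreeOf_sub_le l P Q).trans (max_le (hP l) (hQ l)),
    fun x hx => ?_⟩
  simp [hfP x hx, hgQ x hx]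

lemma piecewisePoly_gridCells_mono {d : ℕ} (r : Fin d → ℕ) {L' L : Fin d → ℕ} (h : L' ≤ L) :
    piecewisePoly r (gridCells L' : Set (DyadicRectangle d)) ⊆
      piecewisePoly r (gridCells L : Set (DyadicRectangle d)) := by
  intro f hf K hK
  by_cases hne : K.toSet.Nonempty
  · obtain ⟨x, hx⟩ := hne
    have hxc := K.toSet_subset hx
    have hKx : cell L x = K := by
      have hKL : K.level = L := by simpa using hK
      rw [← hKL]
      exact (mem_toSet_iff K hxc).1 hx
    obtain ⟨P, hP, hfP⟩ := hf (cell L' x) (by simp [cell])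
    refine ⟨P, hP, fun y hy => hfP y (cell_subset_of_le h hxc ?_)⟩
    rwa [hKx]
  · exact ⟨0, by simp, fun x hx => (hne ⟨x, hx⟩).elim⟩

/-- Interpolation between `L_p` and `L_∞`. -/
lemma eLpNorm_le_of_bound_of_lintegral_le {α : Type*} [MeasurableSpace α] {μ : Measure α}
    {f : α → ℝ} {p q : ℝ≥0∞} (hp0 : 0 < p) (hpq : p < q) {M A : ℝ≥0∞} (hM : M ≠ ∞)
    (hfM : ∀ᵐ x ∂μ, ‖f x‖ₑ ^ p.toReal ≤ M) (hfA : ∫⁻ x, ‖f x‖ₑ ^ p.toReal ∂μ ≤ A) :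
    eLpNorm f q μ ≤ M ^ (p.toReal⁻¹ - q.toReal⁻¹) * A ^ q.toReal⁻¹ := by
  have hpt : p ≠ ∞ := hpq.ne_top
  have hpr : 0 < p.toReal := ENNReal.toReal_pos hp0.ne' hpt
  rcases eq_or_ne q ∞ with rfl | hq
  · simp only [ENNReal.toReal_top, inv_zero, sub_zero, ENNReal.rpow_zero, mul_one,
      eLpNorm_exponent_top]
    refine eLpNormEssSup_le_of_ae_enorm_bound ?_
    filter_upwards [hfM] with x hx
    rwa [ENNReal.le_rpow_inv_iff hpr]
  · have hpqr : p.toReal < q.toReal := (ENNReal.toReal_lt_toReal hpt hq).2 hpq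
    have hqr : 0 < q.toReal := hpr.trans hpqr
    rw [eLpNorm_eq_lintegral_rpow_enorm_toReal (hp0.trans hpq).ne' hq]
    set e : ℝ := (q.toReal - p.toReal) / p.toReal with he
    have he0 : 0 ≤ e := div_nonneg (sub_nonneg.2 hpqr.le) hpr.le
    have key : ∫⁻ x, ‖f x‖ₑ ^ q.toReal ∂μ ≤ M ^ e * A := by
      calc ∫⁻ x, ‖f x‖ₑ ^ q.toReal ∂μ ≤ ∫⁻ x, M ^ e * ‖f x‖ₑ ^ p.toReal ∂μ := by
            refine lintegral_mono_ae ?_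
            filter_upwards [hfM] with x hx
            calc ‖f x‖ₑ ^ q.toReal = (‖f x‖ₑ ^ p.toReal) ^ e * ‖f x‖ₑ ^ p.toReal := by
                  rw [← ENNReal.rpow_mul, ← ENNReal.rpow_add_of_nonneg _ _
                    (mul_nonneg hpr.le he0) hpr.le]
                  congr 1
                  rw [he]
                  field_simp
                  ring
              _ ≤ M ^ e * ‖f x‖ₑ ^ p.toReal := by
                  gcongr
        _ = M ^ e * ∫⁻ x, ‖f x‖ₑ ^ p.toReal ∂μ :=
            lintegral_const_mul' _ _ (ENNReal.rpow_ne_top_of_nonneg he0 hM)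
        _ ≤ M ^ e * A := by gcongr
    calc (∫⁻ x, ‖f x‖ₑ ^ q.toReal ∂μ) ^ (1 / q.toReal) ≤ (M ^ e * A) ^ (1 / q.toReal) := by
          gcongr
      _ = M ^ (p.toReal⁻¹ - q.toReal⁻¹) * A ^ q.toReal⁻¹ := by
          rw [ENNReal.mul_rpow_of_nonneg _ _ (by positivity), ← ENNReal.rpow_mul, one_div]
          congr 2
          rw [he]
          field_simp

/-- If a function is polynomial on the cells of a grid, then deleting the (at most `ν`) cells that
carry most of the `L_p` quasi-norm leaves a function with small `L_q` norm. -/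
lemma exists_marked_cells {d : ℕ} {r : Fin d → ℕ} {p q : ℝ≥0∞} (hp0 : 0 < p) (hpq : p < q)
    {C : ℝ} (hC : 0 < C)
    (hNik : ∀ (K : DyadicRectangle d) (P : MvPolynomial (Fin d) ℝ),
      (∀ l, P.degreeOf l ≤ r l) → ∀ x ∈ K.toSet,
        ‖MvPolynomial.eval x P‖ₑ ^ p.toReal ≤ ENNReal.ofReal (C * 2 ^ ∑ l, K.level l) *
          ∫⁻ y in K.toSet, ‖MvPolynomial.eval y P‖ₑ ^ p.toReal)
    {L : Fin d → ℕ} {f : (Fin d → ℝ) → ℝ}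
    (hf : f ∈ piecewisePoly r (gridCells L : Set (DyadicRectangle d))) {E : ℝ} (hE : 0 < E)
    (hfE : eLpNorm f p (cubeMeasure d) ≤ ENNReal.ofReal E) {ν : ℝ} (hν : 0 < ν) :
    ∃ Λ : Finset (DyadicRectangle d), (Λ.card : ℝ) ≤ ν ∧
      ∃ h : (Fin d → ℝ) → ℝ, AEStronglyMeasurable h (cubeMeasure d) ∧
        (∀ x ∈ Icc (0 : Fin d → ℝ) 1, cell L x ∉ Λ → h x = f x) ∧
        eLpNorm h q (cubeMeasure d) ≤ ENNReal.ofReal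
          ((C * 2 ^ (∑ l, L l) / ν) ^ (p.toReal⁻¹ - q.toReal⁻¹) * E) := by
  classical
  have hpt : p ≠ ∞ := hpq.ne_top
  have hpr : 0 < p.toReal := ENNReal.toReal_pos hp0.ne' hpt
  have hγ : 0 ≤ p.toReal⁻¹ - q.toReal⁻¹ := by
    rcases eq_or_ne q ∞ with rfl | hq
    · simp
    · have := (ENNReal.toReal_lt_toReal hpt hq).2 hpq
      exact sub_nonneg.2 (inv_anti₀ hpr this.le)
  set A : ℝ := E ^ p.toReal with hA
  have hA0 : 0 < A := Real.rpow_pos_of_pos hE _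
  have hfA : ∫⁻ x, ‖f x‖ₑ ^ p.toReal ∂cubeMeasure d ≤ ENNReal.ofReal A := by
    rw [eLpNorm_eq_lintegral_rpow_enorm_toReal hp0.ne' hpt, one_div,
      ENNReal.rpow_inv_le_iff hpr] at hfE
    rwa [hA, ← ENNReal.ofReal_rpow_of_nonneg hE.le hpr.le]
  set ε : ℝ := A / ν with hε
  have hε0 : 0 < ε := div_pos hA0 hν
  let Λ : Finset (DyadicRectangle d) := (gridCells L).filter
    fun K => ENNReal.ofReal ε < ∫⁻ x in K.toSet, ‖f x‖ₑ ^ p.toReal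
  have hΛ : ∀ K ∈ gridCells L, K ∉ Λ →
      ∫⁻ x in K.toSet, ‖f x‖ₑ ^ p.toReal ≤ ENNReal.ofReal ε := by
    intro K hK hKΛ
    by_contra hcon
    exact hKΛ (Finset.mem_filter.2 ⟨hK, not_le.1 hcon⟩)
  let h : (Fin d → ℝ) → ℝ := fun x => if cell L x ∈ Λ then 0 else f x
  have hcell : ∀ K ∈ gridCells L, ∀ x ∈ K.toSet, cell L x = K := by
    intro K hK x hx
    have hKL : K.level = L := by simpa using hK
    rw [← hKL]
    exact (mem_toSet_iff K (K.toSet_subset hx)).1 hx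
  refine ⟨Λ, ?_, h, ?_, fun x _ hx => if_neg hx, ?_⟩
  · have h1 : (Λ.card : ℝ≥0∞) * ENNReal.ofReal ε ≤ ENNReal.ofReal A := by
      calc (Λ.card : ℝ≥0∞) * ENNReal.ofReal ε = ∑ K ∈ Λ, ENNReal.ofReal ε := by simp
        _ ≤ ∑ K ∈ Λ, ∫⁻ x in K.toSet, ‖f x‖ₑ ^ p.toReal :=
            Finset.sum_le_sum fun K hK => (Finset.mem_filter.1 hK).2.le
        _ ≤ ∑ K ∈ gridCells L, ∫⁻ x in K.toSet, ‖f x‖ₑ ^ p.toReal :=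
            Finset.sum_le_sum_of_subset (Finset.filter_subset _ _)
        _ ≤ ENNReal.ofReal A := by rwa [← lintegral_cubeMeasure_eq_sum L]
    rw [← ENNReal.ofReal_natCast, ← ENNReal.ofReal_mul (by positivity),
      ENNReal.ofReal_le_ofReal_iff hA0.le, hε, mul_div_assoc', div_le_iff₀ hν, mul_comm] at h1
    exact le_of_mul_le_mul_left h1 hA0
  · refine aestronglyMeasurable_of_gridCells L fun K hK => ?_
    by_cases hKΛ : K ∈ Λ
    · exact ⟨fun _ => 0, measurable_const, fun x hx => if_pos (by rwa [hcell K hK x hx])⟩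
    · obtain ⟨P, -, hP⟩ := hf K hK
      refine ⟨_, (MvPolynomial.continuous_eval P).measurable, fun x hx => ?_⟩
      rw [← hP x hx]
      exact if_neg (by rwa [hcell K hK x hx])
  · have hle : ∀ x, ‖h x‖ₑ ≤ ‖f x‖ₑ := by
      intro x
      simp only [h]
      split_ifs <;> simp
    have hD : 0 < C * 2 ^ ∑ l, L l := by positivity
    refine (eLpNorm_le_of_bound_of_lintegral_le hp0 hpq
      (M := ENNReal.ofReal (C * 2 ^ (∑ l, L l) * ε)) ENNReal.ofReal_ne_top ?_
      ((lintegral_mono fun x => ENNReal.rpow_le_rpow (hle x) hpr.le).trans hfA)).trans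
      (le_of_eq ?_)
    · filter_upwards [ae_restrict_mem measurableSet_Icc] with x hx
      by_cases hxΛ : cell L x ∈ Λ
      · simp [h, hxΛ, ENNReal.zero_rpow_of_pos hpr]
      · have hg : cell L x ∈ gridCells L := by simp [cell]
        obtain ⟨P, hPr, hP⟩ := hf (cell L x) hg
        have hx' := mem_cell L hx
        have hb := hNik (cell L x) P hPr x hx'
        rw [show h x = f x from if_neg hxΛ, hP x hx', ENNReal.ofReal_mul hD.le]
        refine hb.trans (mul_le_mul_right ?_ _)
        refine le_trans (le_of_eq ?_) (hΛ _ hg hxΛ)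
        refine setLIntegral_congr_fun (measurableSet_toSet _) fun y hy => ?_
        simp only [hP y hy]
    · rw [ENNReal.ofReal_rpow_of_nonneg (by positivity) hγ,
        ENNReal.ofReal_rpow_of_nonneg hA0.le (by positivity),
        ← ENNReal.ofReal_mul (by positivity)]
      congr 1
      rw [hε, mul_div_assoc', mul_div_right_comm, Real.mul_rpow (by positivity) hA0.le, mul_assoc,
        ← Real.rpow_add hA0, sub_add_cancel, hA, ← Real.rpow_mul hE.le,
        mul_inv_cancel₀ hpr.ne', Real.rpow_one]

lemma sub_eq_sum_Ioc {E : Type*} [AddCommGroup E] (f : ℕ → E) {a n : ℕ} (h : a ≤ n) :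
    f n - f a = ∑ i ∈ Finset.Ioc a n, (f i - f (i - 1)) := by
  induction n, h using Nat.le_induction with
  | base => simp
  | succ n hn ih =>
    rw [← Finset.insert_Ioc_right_eq_Ioc_add_one hn, Finset.sum_insert (by simp), ← ih]
    simp

/-- An `L_q` error bound by telescoping, for a sequence that converges in `L_p`. -/
lemma eLpNorm_sub_le_of_telescope {α : Type*} [MeasurableSpace α] {μ : Measure α} {p q : ℝ≥0∞}
    (hp0 : p ≠ 0) (hq : 1 ≤ q) {s : α → ℝ} (hs : AEStronglyMeasurable s μ) {P : ℕ → α → ℝ}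
    (hP : ∀ n, AEStronglyMeasurable (P n) μ)
    (hlim : Filter.Tendsto (fun n => eLpNorm (P n - s) p μ) Filter.atTop (nhds 0)) (J : ℕ)
    {B : ℝ≥0∞} (hB : ∀ n, ∑ i ∈ Finset.Ioc J n, eLpNorm (P i - P (i - 1)) q μ ≤ B) :
    eLpNorm (s - P J) q μ ≤ B := by
  obtain ⟨ns, hns, hae⟩ :=
    (tendstoInMeasure_of_tendsto_eLpNorm hp0 hP hs hlim).exists_seq_tendsto_ae
  refine (Lp.eLpNorm_lim_le_liminf_eLpNorm (f := fun n => P (ns n) - P J)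
    (fun n => (hP _).sub (hP J)) (s - P J) ?_).trans ?_
  · filter_upwards [hae] with x hx
    exact hx.sub_const _
  · refine Filter.liminf_le_of_frequently_le' (Filter.Eventually.frequently ?_)
    filter_upwards [Filter.eventually_ge_atTop J] with n hn
    have hJn : J ≤ ns n := hn.trans (hns.id_le n)
    rw [sub_eq_sum_Ioc P hJn]
    exact (eLpNorm_sum_le (fun i _ => (hP i).sub (hP _)) hq).trans (hB _)

/-! ### The anisotropic grids -/

/-- The level of the rectangles of `dyadicLevel σ j`. -/
noncomputable def gridLevel {d : ℕ} (σ : Fin d → ℝ) (j : ℕ) : Fin d → ℕ :=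
  fun l => ⌊(j : ℝ) * sigmaMin σ / σ l⌋₊

lemma dyadicLevel_eq_gridCells {d : ℕ} (σ : Fin d → ℝ) (j : ℕ) :
    dyadicLevel σ j = gridCells (gridLevel σ j) := by
  ext K
  simp [dyadicLevel, gridLevel, funext_iff]

lemma sigmaMin_le {d : ℕ} (σ : Fin d → ℝ) (l : Fin d) : sigmaMin σ ≤ σ l :=
  ciInf_le (Set.finite_range σ).bddBelow l

lemma sigmaMin_pos {d : ℕ} (hd : 0 < d) {σ : Fin d → ℝ} (hσ : ∀ l, 0 < σ l) :
    0 < sigmaMin σ := by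
  have : Nonempty (Fin d) := ⟨⟨0, hd⟩⟩
  obtain ⟨l, hl⟩ := exists_eq_ciInf_of_finite (f := σ)
  rw [sigmaMin, ← hl]
  exact hσ l

lemma sum_inv_pos {d : ℕ} (hd : 0 < d) {σ : Fin d → ℝ} (hσ : ∀ l, 0 < σ l) :
    0 < ∑ l, 1 / σ l :=
  Finset.sum_pos (fun l _ => one_div_pos.2 (hσ l)) ⟨⟨0, hd⟩, Finset.mem_univ _⟩

lemma harmonicMean_eq {d : ℕ} (σ : Fin d → ℝ) : harmonicMean σ = d / ∑ l, 1 / σ l := by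
  rw [harmonicMean, mul_inv, one_div, inv_inv, div_eq_mul_inv]

lemma monotone_gridLevel {d : ℕ} (hd : 0 < d) {σ : Fin d → ℝ} (hσ : ∀ l, 0 < σ l) :
    Monotone (gridLevel σ) := by
  intro i j hij l
  have := (sigmaMin_pos hd hσ).le
  have := hσ l
  have : (i : ℝ) ≤ j := by exact_mod_cast hij
  unfold gridLevel
  gcongr

lemma gridLevel_succ_le {d : ℕ} (hd : 0 < d) {σ : Fin d → ℝ} (hσ : ∀ l, 0 < σ l) (j : ℕ)
    (l : Fin d) : gridLevel σ (j + 1) l ≤ gridLevel σ j l + 1 := by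
  have h0 := (sigmaMin_pos hd hσ).le
  have h1 : sigmaMin σ / σ l ≤ 1 := (div_le_one (hσ l)).2 (sigmaMin_le σ l)
  have h2 : 0 ≤ (j : ℝ) * sigmaMin σ / σ l :=
    div_nonneg (mul_nonneg (Nat.cast_nonneg _) h0) (hσ l).le
  unfold gridLevel
  rw [← Nat.floor_add_one h2]
  refine Nat.floor_mono ?_
  push_cast
  rw [add_mul, one_mul, add_div]
  linarith

lemma two_pow_sum_gridLevel_le {d : ℕ} (hd : 0 < d) {σ : Fin d → ℝ} (hσ : ∀ l, 0 < σ l)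
    (j : ℕ) :
    (2 : ℝ) ^ ∑ l, gridLevel σ j l ≤ (2 : ℝ) ^ ((j : ℝ) * (sigmaMin σ * ∑ l, 1 / σ l)) := by
  rw [← Real.rpow_natCast]
  refine Real.rpow_le_rpow_of_exponent_le one_le_two ?_
  push_cast
  rw [Finset.mul_sum, Finset.mul_sum]
  refine Finset.sum_le_sum fun l _ => ?_
  have h0 := (sigmaMin_pos hd hσ).le
  have h2 : 0 ≤ (j : ℝ) * sigmaMin σ / σ l :=
    div_nonneg (mul_nonneg (Nat.cast_nonneg _) h0) (hσ l).le
  refine (Nat.floor_le h2).trans (le_of_eq ?_)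
  ring

lemma le_sidelength_of_level_eq {d : ℕ} (hd : 0 < d) {σ : Fin d → ℝ} (hσ : ∀ l, 0 < σ l)
    {j J : ℕ} (hj : j ≤ J) {K : DyadicRectangle d} (hK : K.level = gridLevel σ j) (l : Fin d) :
    (2 : ℝ) ^ (-((J : ℝ) * sigmaMin σ / σ l)) ≤ K.sidelength l := by
  have h0 := (sigmaMin_pos hd hσ).le
  have h2 : 0 ≤ (J : ℝ) * sigmaMin σ / σ l :=
    div_nonneg (mul_nonneg (Nat.cast_nonneg _) h0) (hσ l).le
  rw [DyadicRectangle.sidelength, hK, Real.rpow_neg zero_le_two, one_div]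
  refine inv_anti₀ (by positivity) ?_
  rw [← Real.rpow_natCast]
  refine Real.rpow_le_rpow_of_exponent_le one_le_two ?_
  refine le_trans ?_ (Nat.floor_le h2)
  exact_mod_cast monotone_gridLevel hd hσ hj l

/-! ### Approximation on the grids -/

instance isProbabilityMeasure_cubeMeasure (d : ℕ) : IsProbabilityMeasure (cubeMeasure d) :=
  ⟨by simp [cubeMeasure, Real.volume_Icc_pi]⟩

lemma weightedError_le_of_mem {d : ℕ} {r : Fin d → ℕ} {σ : Fin d → ℝ} {p p' : ℝ≥0∞} {R : ℝ}
    {s : (Fin d → ℝ) → ℝ} (hp' : p' ≠ 0) (hs : s ∈ smoothnessClass r σ p p' R) (k : ℕ) :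
    weightedError r σ p s k ≤ ENNReal.ofReal R := by
  refine le_trans ?_ hs.2
  unfold smoothnessNorm
  split_ifs with h
  · exact le_iSup (weightedError r σ p s) k
  · have hpr : 0 < p'.toReal := ENNReal.toReal_pos hp' h
    rw [one_div, ENNReal.le_rpow_inv_iff hpr]
    exact ENNReal.le_tsum k

lemma exists_approx_sequence {d : ℕ} {r : Fin d → ℕ} {σ : Fin d → ℝ} {p p' : ℝ≥0∞} {R : ℝ}
    (hR : 0 < R) {s : (Fin d → ℝ) → ℝ} (hp' : p' ≠ 0) (hs : s ∈ smoothnessClass r σ p p' R) :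
    ∃ P : ℕ → (Fin d → ℝ) → ℝ, ∀ k,
      P k ∈ piecewisePoly r (gridCells (gridLevel σ k) : Set (DyadicRectangle d)) ∧
      eLpNorm (s - P k) p (cubeMeasure d) ≤
        ENNReal.ofReal (2 * R * (2 : ℝ) ^ (-((k : ℝ) * sigmaMin σ))) := by
  suffices key : ∀ k : ℕ, ∃ t : (Fin d → ℝ) → ℝ,
      t ∈ piecewisePoly r (gridCells (gridLevel σ k) : Set (DyadicRectangle d)) ∧
      eLpNorm (s - t) p (cubeMeasure d) ≤
        ENNReal.ofReal (2 * R * (2 : ℝ) ^ (-((k : ℝ) * sigmaMin σ))) by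
    choose P hP using key
    exact ⟨P, hP⟩
  intro k
  have h := weightedError_le_of_mem hp' hs k
  have h2 : (0 : ℝ) < (2 : ℝ) ^ ((k : ℝ) * sigmaMin σ) := by positivity
  have hlt : approxError p (piecewisePoly r (dyadicLevel σ k)) s <
      ENNReal.ofReal (2 * R * (2 : ℝ) ^ (-((k : ℝ) * sigmaMin σ))) := by
    refine lt_of_le_of_lt ((ENNReal.le_div_iff_mul_le (Or.inl (ENNReal.ofReal_pos.2 h2).ne')
      (Or.inl ENNReal.ofReal_ne_top)).2 ((mul_comm _ _).trans_le h)) ?_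
    rw [← ENNReal.ofReal_div_of_pos h2, Real.rpow_neg zero_le_two, ← div_eq_mul_inv]
    refine (ENNReal.ofReal_lt_ofReal_iff (by positivity)).2 ?_
    gcongr
    linarith
  rw [approxError, iInf_lt_iff] at hlt
  obtain ⟨t, ht⟩ := hlt
  rw [iInf_lt_iff] at ht
  obtain ⟨htm, ht⟩ := ht
  rw [dyadicLevel_eq_gridCells] at htm
  exact ⟨t, htm, ht.le⟩

/-- Consecutive approximations are close to each other; the truncated subtraction is harmless, as
for `i = 0` the difference vanishes. -/
lemma eLpNorm_sub_pred_le {α : Type*} [MeasurableSpace α] {μ : Measure α} {p : ℝ≥0∞} {R η : ℝ}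
    (hR : 0 < R) (hη : 0 < η) {s : α → ℝ} (hs : AEStronglyMeasurable s μ) {P : ℕ → α → ℝ}
    (hP : ∀ k, AEStronglyMeasurable (P k) μ)
    (hsP : ∀ k : ℕ, eLpNorm (s - P k) p μ ≤ ENNReal.ofReal (2 * R * (2 : ℝ) ^ (-((k : ℝ) * η))))
    (i : ℕ) :
    eLpNorm (P i - P (i - 1)) p μ ≤ ENNReal.ofReal
      (((ENNReal.LpAddConst p).toReal + 1) * (2 + 2 * (2 : ℝ) ^ η) * R *
        (2 : ℝ) ^ (-((i : ℝ) * η))) := by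
  have he : P i - P (i - 1) = (s - P (i - 1)) - (s - P i) := by abel
  have hK : ENNReal.LpAddConst p = ENNReal.ofReal (ENNReal.LpAddConst p).toReal :=
    (ENNReal.ofReal_toReal (ENNReal.LpAddConst_lt_top p).ne).symm
  set κ := (ENNReal.LpAddConst p).toReal with hκ
  have hκ0 : 0 ≤ κ := ENNReal.toReal_nonneg
  rw [he]
  refine (eLpNorm_sub_le' (hs.sub (hP _)) (hs.sub (hP _)) p).trans ?_
  refine (mul_le_mul_right (add_le_add (hsP _) (hsP _)) _).trans ?_
  rw [hK, ← ENNReal.ofReal_add (by positivity) (by positivity), ← ENNReal.ofReal_mul hκ0]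
  refine ENNReal.ofReal_le_ofReal ?_
  have hpred : (2 : ℝ) ^ (-(((i - 1 : ℕ) : ℝ) * η)) ≤ (2 : ℝ) ^ η * (2 : ℝ) ^ (-((i : ℝ) * η)) := by
    rw [← Real.rpow_add two_pos]
    refine Real.rpow_le_rpow_of_exponent_le one_le_two ?_
    have : (i : ℝ) ≤ ((i - 1 : ℕ) : ℝ) + 1 := by exact_mod_cast (by omega : i ≤ i - 1 + 1)
    nlinarith
  have hx : 0 < (2 : ℝ) ^ (-((i : ℝ) * η)) := by positivity
  calc κ * (2 * R * (2 : ℝ) ^ (-(((i - 1 : ℕ) : ℝ) * η)) + 2 * R * (2 : ℝ) ^ (-((i : ℝ) * η)))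
      ≤ (κ + 1) * (2 * R * ((2 : ℝ) ^ η * (2 : ℝ) ^ (-((i : ℝ) * η))) +
          2 * R * (2 : ℝ) ^ (-((i : ℝ) * η))) := by
        gcongr
        linarith
    _ = _ := by ring

lemma sum_Ioc_le_tsum {f : ℕ → ℝ} (hf : Summable f) (h0 : ∀ n, 0 ≤ f n) (a n : ℕ) :
    ∑ i ∈ Finset.Ioc a n, f (i - a) ≤ ∑' u, f u := by
  have hinj : Set.InjOn (fun i => i - a) (Finset.Ioc a n : Set ℕ) := by
    intro i hi j hj hij
    simp only [Finset.coe_Ioc, mem_Ioc] at hi hj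
    simp only at hij
    omega
  rw [← Finset.sum_image (f := f) hinj]
  exact hf.sum_le_tsum _ fun n _ => h0 n

/-- The starting generation `min J ⌊k d / β⌋`, where `β = σ_min ∑ 1 / σ_l`, has at most `2 ^ (k d)`
cells. -/
lemma two_pow_sum_gridLevel_start_le {d : ℕ} (hd : 0 < d) {σ : Fin d → ℝ} (hσ : ∀ l, 0 < σ l)
    (J k : ℕ) :
    (2 : ℝ) ^ ∑ l, gridLevel σ (min J ⌊(k * d : ℝ) / (sigmaMin σ * ∑ l, 1 / σ l)⌋₊) l ≤
      2 ^ (k * d) := by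
  refine (two_pow_sum_gridLevel_le hd hσ _).trans ?_
  have hβ : 0 < sigmaMin σ * ∑ l, 1 / σ l := mul_pos (sigmaMin_pos hd hσ) (sum_inv_pos hd hσ)
  rw [← Real.rpow_natCast 2 (k * d)]
  refine Real.rpow_le_rpow_of_exponent_le one_le_two ?_
  rw [← le_div_iff₀ hβ]
  push_cast
  exact (min_le_right _ _).trans (Nat.floor_le (by positivity))

/-- If the starting generation is not the last one, then it has at least of the order of
`2 ^ (k d)` cells. -/
lemma two_rpow_start_le {J k d : ℕ} {β ρ : ℝ} (hρ : 0 ≤ ρ)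
    (h : min J ⌊(k * d : ℝ) / β⌋₊ ≠ J) :
    (2 : ℝ) ^ (-(((min J ⌊(k * d : ℝ) / β⌋₊ : ℕ) : ℝ) * ρ)) ≤
      (2 : ℝ) ^ ρ * (2 : ℝ) ^ (-((k * d : ℝ) / β * ρ)) := by
  rw [← Real.rpow_add two_pos]
  refine Real.rpow_le_rpow_of_exponent_le one_le_two ?_
  have h1 : min J ⌊(k * d : ℝ) / β⌋₊ = ⌊(k * d : ℝ) / β⌋₊ := by omega
  rw [h1]
  nlinarith [Nat.lt_floor_add_one ((k * d : ℝ) / β)]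

/-! ### Approximation rates -/

/-- For `q ≤ p`, approximation on a regular grid has the required rate. -/
lemma exists_linear_approx {d : ℕ} (hd : 0 < d) {σ : Fin d → ℝ} (hσ : ∀ l, 0 < σ l)
    {r : Fin d → ℕ} {p q : ℝ≥0∞} (hqp : q ≤ p) {R : ℝ} (hR : 0 < R) {s : (Fin d → ℝ) → ℝ}
    (hs : AEStronglyMeasurable s (cubeMeasure d)) {P : ℕ → (Fin d → ℝ) → ℝ}
    (hP : ∀ k, P k ∈ piecewisePoly r (gridCells (gridLevel σ k) : Set (DyadicRectangle d)))
    (hsP : ∀ k : ℕ, eLpNorm (s - P k) p (cubeMeasure d) ≤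
      ENNReal.ofReal (2 * R * (2 : ℝ) ^ (-((k : ℝ) * sigmaMin σ)))) (J k : ℕ) :
    ∃ m : Finset (DyadicRectangle d), IsDyadicPartition m ∧
      (∀ K ∈ m, ∃ j ≤ J, K.level = gridLevel σ j) ∧ (m.card : ℝ) ≤ 2 ^ (k * d) ∧
      approxError q (piecewisePoly r (m : Set _)) s ≤ ENNReal.ofReal (2 * (2 : ℝ) ^ sigmaMin σ * R *
        ((2 : ℝ) ^ (-((J : ℝ) * sigmaMin σ)) + (2 : ℝ) ^ (-((k : ℝ) * harmonicMean σ)))) := by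
  have hσ0 := sigmaMin_pos hd hσ
  have hS0 := sum_inv_pos hd hσ
  set a := min J ⌊(k * d : ℝ) / (sigmaMin σ * ∑ l, 1 / σ l)⌋₊
  refine ⟨gridCells (gridLevel σ a), isDyadicPartition_gridCells _, ?_, ?_, ?_⟩
  · exact fun K hK => ⟨a, min_le_left _ _, by simpa using hK⟩
  · have hcard : ((gridCells (gridLevel σ a)).card : ℝ) ≤ 2 ^ ∑ l, gridLevel σ a l := by
      exact_mod_cast card_gridCells_le (gridLevel σ a)
    exact hcard.trans (two_pow_sum_gridLevel_start_le hd hσ J k)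
  · refine (iInf₂_le (P a) (hP a)).trans ?_
    have hPm := aestronglyMeasurable_of_mem_piecewisePoly (hP a)
    refine (eLpNorm_le_eLpNorm_of_exponent_le hqp (hs.sub hPm)).trans ((hsP a).trans ?_)
    refine ENNReal.ofReal_le_ofReal ?_
    have h1 : 1 ≤ (2 : ℝ) ^ sigmaMin σ := Real.one_le_rpow one_le_two hσ0.le
    have key : (2 : ℝ) ^ (-((a : ℝ) * sigmaMin σ)) ≤ (2 : ℝ) ^ sigmaMin σ *
        ((2 : ℝ) ^ (-((J : ℝ) * sigmaMin σ)) + (2 : ℝ) ^ (-((k : ℝ) * harmonicMean σ))) := by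
      by_cases haJ : a = J
      · rw [haJ]
        have h2 : 0 < (2 : ℝ) ^ (-((J : ℝ) * sigmaMin σ)) := by positivity
        have h3 : 0 < (2 : ℝ) ^ (-((k : ℝ) * harmonicMean σ)) := by positivity
        nlinarith
      · refine (two_rpow_start_le hσ0.le haJ).trans ?_
        rw [show (k * d : ℝ) / (sigmaMin σ * ∑ l, 1 / σ l) * sigmaMin σ = k * harmonicMean σ by
          rw [harmonicMean_eq]; field_simp]
        gcongr
        exact le_add_of_nonneg_left (by positivity)
    calc 2 * R * (2 : ℝ) ^ (-((a : ℝ) * sigmaMin σ)) ≤ 2 * R * ((2 : ℝ) ^ sigmaMin σ *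
          ((2 : ℝ) ^ (-((J : ℝ) * sigmaMin σ)) + (2 : ℝ) ^ (-((k : ℝ) * harmonicMean σ)))) := by
          gcongr
      _ = _ := by ring

lemma marked_bound_le {d : ℕ} (hd : 0 < d) {σ : Fin d → ℝ} (hσ : ∀ l, 0 < σ l) {C E ν γ : ℝ}
    (hC : 0 < C) (hE : 0 < E) (hν : 0 < ν) (hγ : 0 ≤ γ) (i : ℕ) :
    (C * 2 ^ (∑ l, gridLevel σ i l) / ν) ^ γ * (E * (2 : ℝ) ^ (-((i : ℝ) * sigmaMin σ))) ≤
      (C / ν) ^ γ * E *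
        (2 : ℝ) ^ (-((i : ℝ) * (sigmaMin σ - sigmaMin σ * (∑ l, 1 / σ l) * γ))) := by
  have h1 : C * 2 ^ (∑ l, gridLevel σ i l) / ν ≤
      C / ν * (2 : ℝ) ^ ((i : ℝ) * (sigmaMin σ * ∑ l, 1 / σ l)) := by
    rw [mul_div_right_comm]
    gcongr
    exact two_pow_sum_gridLevel_le hd hσ i
  calc (C * 2 ^ (∑ l, gridLevel σ i l) / ν) ^ γ * (E * (2 : ℝ) ^ (-((i : ℝ) * sigmaMin σ)))
      ≤ (C / ν * (2 : ℝ) ^ ((i : ℝ) * (sigmaMin σ * ∑ l, 1 / σ l))) ^ γ *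
          (E * (2 : ℝ) ^ (-((i : ℝ) * sigmaMin σ))) := by
        gcongr
    _ = (C / ν) ^ γ * E * ((2 : ℝ) ^ ((i : ℝ) * (sigmaMin σ * ∑ l, 1 / σ l) * γ) *
          (2 : ℝ) ^ (-((i : ℝ) * sigmaMin σ))) := by
        rw [Real.mul_rpow (by positivity) (by positivity), ← Real.rpow_mul zero_le_two]
        ring
    _ = _ := by
        rw [← Real.rpow_add two_pos]
        congr 2
        ring

lemma two_rpow_neg_eq_mul_pow {a i : ℕ} (h : a ≤ i) (ρ : ℝ) :
    (2 : ℝ) ^ (-((i : ℝ) * ρ)) = (2 : ℝ) ^ (-((a : ℝ) * ρ)) * ((2 : ℝ) ^ (-ρ)) ^ (i - a) := by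
  rw [← Real.rpow_natCast, ← Real.rpow_mul zero_le_two, ← Real.rpow_add two_pos, Nat.cast_sub h]
  congr 1
  ring

lemma two_rpow_neg_lt_one {ρ : ℝ} (hρ : 0 < ρ) : (2 : ℝ) ^ (-ρ) < 1 :=
  Real.rpow_lt_one_of_one_lt_of_neg one_lt_two (neg_neg_of_pos hρ)

/-- For `p < q`, adaptive approximation has the required rate. Here `ρ` is the rate of convergence
in `L_q` along the regular grids. In generation `i` at most `c 2 ^ (k d) 2 ^ (-δ (i - a))` cells are
marked. The exponent `δ = ρ / (2 γ)` makes the number of cells decay with `i`, while the `L_q` norm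
off the marked cells still decays like `2 ^ (-ρ i / 2)`; the factor `c` keeps the total number of
cells below a bound that does not depend on `δ`, hence not on `q`. -/
lemma exists_adaptive_approx {d : ℕ} (hd : 0 < d) {σ : Fin d → ℝ} (hσ : ∀ l, 0 < σ l)
    (r : Fin d → ℕ) {p q : ℝ≥0∞} (hp0 : 0 < p) (hpq : p < q) (hq : 1 ≤ q) {γ ρ : ℝ}
    (hγ : γ = p.toReal⁻¹ - q.toReal⁻¹) (hγ0 : 0 < γ)
    (hρ : ρ = sigmaMin σ - sigmaMin σ * (∑ l, 1 / σ l) * γ) (hρ0 : 0 < ρ) :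
    ∃ C₃ : ℝ, 0 < C₃ ∧ ∀ R : ℝ, 0 < R → ∀ s : (Fin d → ℝ) → ℝ,
      AEStronglyMeasurable s (cubeMeasure d) → ∀ P : ℕ → (Fin d → ℝ) → ℝ,
      (∀ k, P k ∈ piecewisePoly r (gridCells (gridLevel σ k) : Set (DyadicRectangle d))) →
      (∀ k : ℕ, eLpNorm (s - P k) p (cubeMeasure d) ≤
        ENNReal.ofReal (2 * R * (2 : ℝ) ^ (-((k : ℝ) * sigmaMin σ)))) → ∀ J k : ℕ,
      ∃ m : Finset (DyadicRectangle d), IsDyadicPartition m ∧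
        (∀ K ∈ m, ∃ j ≤ J, K.level = gridLevel σ j) ∧
        (m.card : ℝ) ≤ (1 + 2 ^ d) * 2 ^ (k * d) ∧
        approxError q (piecewisePoly r (m : Set _)) s ≤ ENNReal.ofReal (C₃ * R *
          ((2 : ℝ) ^ (-((J : ℝ) * ρ)) + (2 : ℝ) ^ (-((k : ℝ) * harmonicMean σ)))) := by
  have hσ0 := sigmaMin_pos hd hσ
  have hS0 := sum_inv_pos hd hσ
  have hd0 : (0 : ℝ) < d := by exact_mod_cast hd
  have hpt : p ≠ ∞ := hpq.ne_top
  have hpr : 0 < p.toReal := ENNReal.toReal_pos hp0.ne' hpt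
  obtain ⟨C, hC, hNik⟩ := exists_nikolskii_bound r hpr
  set G : ℝ := ((ENNReal.LpAddConst p).toReal + 1) * (2 + 2 * (2 : ℝ) ^ sigmaMin σ) with hG
  have hG0 : 0 < G := by
    have : 0 ≤ (ENNReal.LpAddConst p).toReal := ENNReal.toReal_nonneg
    positivity
  set δ : ℝ := ρ / (2 * γ) with hδ
  have hδ0 : 0 < δ := by positivity
  have hsum1 : Summable fun u : ℕ => ((2 : ℝ) ^ (-ρ)) ^ u :=
    summable_geometric_of_lt_one (by positivity) (two_rpow_neg_lt_one hρ0)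
  have hsum2 : Summable fun u : ℕ => ((2 : ℝ) ^ (-(ρ / 2))) ^ u :=
    summable_geometric_of_lt_one (by positivity) (two_rpow_neg_lt_one (by positivity))
  have hsum3 : Summable fun u : ℕ => (u : ℝ) * ((2 : ℝ) ^ (-δ)) ^ u := by
    simpa using summable_pow_mul_geometric_of_norm_lt_one 1 (r := (2 : ℝ) ^ (-δ)) (by
      rw [Real.norm_of_nonneg (by positivity)]
      exact two_rpow_neg_lt_one hδ0)
  set T1 : ℝ := ∑' u : ℕ, ((2 : ℝ) ^ (-ρ)) ^ u
  set T2 : ℝ := ∑' u : ℕ, ((2 : ℝ) ^ (-(ρ / 2))) ^ u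
  set W : ℝ := ∑' u : ℕ, (u : ℝ) * ((2 : ℝ) ^ (-δ)) ^ u
  have hT1' : 0 ≤ T1 := tsum_nonneg fun u => by positivity
  have hT2' : 0 ≤ T2 := tsum_nonneg fun u => by positivity
  have hW' : 0 ≤ W := tsum_nonneg fun u => by positivity
  set c : ℝ := (W + 1)⁻¹ with hc
  have hc0 : 0 < c := by positivity
  set D1 : ℝ := (C / (1 / 2)) ^ γ * G * T1 with hD1
  set D2 : ℝ := (C / c) ^ γ * G * T2 * (2 : ℝ) ^ ρ with hD2
  have hD1' : 0 ≤ D1 := by positivity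
  have hD2' : 0 ≤ D2 := by positivity
  refine ⟨D1 + D2 + 1, by positivity, fun R hR s hs P hP hsP J k => ?_⟩
  have hPm : ∀ i, AEStronglyMeasurable (P i) (cubeMeasure d) := fun i =>
    aestronglyMeasurable_of_mem_piecewisePoly (hP i)
  have hmono := monotone_gridLevel hd hσ
  have hgm : ∀ i, P i - P (i - 1) ∈
      piecewisePoly r (gridCells (gridLevel σ i) : Set (DyadicRectangle d)) := fun i =>
    sub_mem_piecewisePoly (hP i)
      (piecewisePoly_gridCells_mono r (hmono (Nat.sub_le i 1)) (hP (i - 1)))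
  -- Used with `ν = 1 / 2`, which means that no cell is marked, and with the numbers of cells that
  -- the refinement may mark.
  have hmark : ∀ (i : ℕ) (ν : ℝ), 0 < ν → ∃ Λ : Finset (DyadicRectangle d), (Λ.card : ℝ) ≤ ν ∧
      ∃ h : (Fin d → ℝ) → ℝ, AEStronglyMeasurable h (cubeMeasure d) ∧
        (∀ x ∈ Icc (0 : Fin d → ℝ) 1, cell (gridLevel σ i) x ∉ Λ → h x = (P i - P (i - 1)) x) ∧
        eLpNorm h q (cubeMeasure d) ≤ ENNReal.ofReal
          ((C / ν) ^ γ * (G * R) * (2 : ℝ) ^ (-((i : ℝ) * ρ))) := by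
    intro i ν hν
    obtain ⟨Λ, hΛ, h, hm, heq, hle⟩ := exists_marked_cells hp0 hpq hC hNik (hgm i)
      (E := G * R * (2 : ℝ) ^ (-((i : ℝ) * sigmaMin σ))) (by positivity)
      (eLpNorm_sub_pred_le hR hσ0 hs hPm hsP i) hν
    refine ⟨Λ, hΛ, h, hm, heq, hle.trans (ENNReal.ofReal_le_ofReal ?_)⟩
    rw [← hγ, hρ]
    exact marked_bound_le hd hσ hC (by positivity) hν hγ0.le i
  have htail : eLpNorm (s - P J) q (cubeMeasure d) ≤
      ENNReal.ofReal (D1 * R * (2 : ℝ) ^ (-((J : ℝ) * ρ))) := by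
    refine eLpNorm_sub_le_of_telescope hp0.ne' hq hs hPm ?_ J fun n => ?_
    · refine tendsto_of_tendsto_of_tendsto_of_le_of_le tendsto_const_nhds ?_
        (fun _ => zero_le) (fun n => (eLpNorm_sub_comm (P n) s p _).trans_le (hsP n))
      rw [← ENNReal.ofReal_zero]
      refine ENNReal.tendsto_ofReal ?_
      have h0 : Filter.Tendsto (fun n : ℕ => 2 * R * ((2 : ℝ) ^ (-sigmaMin σ)) ^ n)
          Filter.atTop (nhds (2 * R * 0)) :=
        (tendsto_pow_atTop_nhds_zero_of_lt_one (by positivity)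
          (two_rpow_neg_lt_one hσ0)).const_mul _
      rw [mul_zero] at h0
      refine h0.congr fun n => ?_
      rw [two_rpow_neg_eq_mul_pow (Nat.zero_le n)]
      simp
    · have hterm : ∀ i ∈ Finset.Ioc J n, eLpNorm (P i - P (i - 1)) q (cubeMeasure d) ≤
          ENNReal.ofReal ((C / (1 / 2)) ^ γ * (G * R) * (2 : ℝ) ^ (-((i : ℝ) * ρ))) := by
        intro i _
        obtain ⟨Λ, hΛ, h, hm, heq, hle⟩ := hmark i (1 / 2) (by norm_num)
        have hΛ0 : Λ = ∅ := by
          rw [← Finset.card_eq_zero]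
          by_contra hne
          have : (1 : ℝ) ≤ Λ.card := by exact_mod_cast Nat.one_le_iff_ne_zero.2 hne
          linarith
        refine le_trans (le_of_eq (eLpNorm_congr_ae ?_)) hle
        filter_upwards [ae_restrict_mem measurableSet_Icc] with x hx
        exact (heq x hx (by simp [hΛ0])).symm
      refine (Finset.sum_le_sum hterm).trans ?_
      rw [← ENNReal.ofReal_sum_of_nonneg fun i _ => by positivity]
      refine ENNReal.ofReal_le_ofReal ?_
      calc ∑ i ∈ Finset.Ioc J n, (C / (1 / 2)) ^ γ * (G * R) * (2 : ℝ) ^ (-((i : ℝ) * ρ))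
          = (C / (1 / 2)) ^ γ * (G * R) * (2 : ℝ) ^ (-((J : ℝ) * ρ)) *
              ∑ i ∈ Finset.Ioc J n, ((2 : ℝ) ^ (-ρ)) ^ (i - J) := by
            rw [Finset.mul_sum]
            refine Finset.sum_congr rfl fun i hi => ?_
            rw [two_rpow_neg_eq_mul_pow (Finset.mem_Ioc.1 hi).1.le]
            ring
        _ ≤ (C / (1 / 2)) ^ γ * (G * R) * (2 : ℝ) ^ (-((J : ℝ) * ρ)) * T1 := by
            gcongr
            exact sum_Ioc_le_tsum hsum1 (fun u => by positivity) J n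
        _ = D1 * R * (2 : ℝ) ^ (-((J : ℝ) * ρ)) := by rw [hD1]; ring
  set a := min J ⌊(k * d : ℝ) / (sigmaMin σ * ∑ l, 1 / σ l)⌋₊
  have haJ : a ≤ J := min_le_left _ _
  choose Λ hΛ h hm heq hle using fun i : ℕ =>
    hmark i (c * 2 ^ (k * d) * ((2 : ℝ) ^ (-δ)) ^ (i - a)) (by positivity)
  obtain ⟨τ, m, hpart, hτ, hτΛ, hmK, hcard⟩ :=
    exists_adaptive_partition hmono (gridLevel_succ_le hd hσ) haJ Λ
  refine ⟨m, hpart, ?_, ?_, ?_⟩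
  · intro K hK
    obtain ⟨x, hx, rfl, -⟩ := hmK K hK
    exact ⟨τ x, (hτ x hx).2, rfl⟩
  · have h1 : ((gridCells (gridLevel σ a)).card : ℝ) ≤ 2 ^ (k * d) := by
      have hcard : ((gridCells (gridLevel σ a)).card : ℝ) ≤ 2 ^ ∑ l, gridLevel σ a l := by
        exact_mod_cast card_gridCells_le (gridLevel σ a)
      exact hcard.trans (two_pow_sum_gridLevel_start_le hd hσ J k)
    have h2 : ∑ i ∈ Finset.Ioc a J, ((i - a : ℕ) : ℝ) * (Λ i).card ≤ 2 ^ (k * d) := by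
      calc ∑ i ∈ Finset.Ioc a J, ((i - a : ℕ) : ℝ) * (Λ i).card
          ≤ ∑ i ∈ Finset.Ioc a J, ((i - a : ℕ) : ℝ) *
              (c * 2 ^ (k * d) * ((2 : ℝ) ^ (-δ)) ^ (i - a)) := by
            gcongr with i hi
            exact hΛ i
        _ = c * 2 ^ (k * d) * ∑ i ∈ Finset.Ioc a J,
              ((i - a : ℕ) : ℝ) * ((2 : ℝ) ^ (-δ)) ^ (i - a) := by
            rw [Finset.mul_sum]
            exact Finset.sum_congr rfl fun i _ => by ring
        _ ≤ c * 2 ^ (k * d) * W := by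
            gcongr
            exact sum_Ioc_le_tsum hsum3 (fun u => by positivity) a J
        _ = W / (W + 1) * 2 ^ (k * d) := by rw [hc]; ring
        _ ≤ 1 * 2 ^ (k * d) := by
            gcongr
            exact (div_le_one (by positivity)).2 (by linarith)
        _ = 2 ^ (k * d) := one_mul _
    calc (m.card : ℝ) ≤ ((gridCells (gridLevel σ a)).card : ℝ) +
          2 ^ d * ∑ i ∈ Finset.Ioc a J, ((i - a : ℕ) : ℝ) * (Λ i).card := by exact_mod_cast hcard
      _ ≤ 2 ^ (k * d) + 2 ^ d * 2 ^ (k * d) := by gcongr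
      _ = (1 + 2 ^ d) * 2 ^ (k * d) := by ring
  · have htmem : (fun x => P (τ x) x) ∈ piecewisePoly r (m : Set (DyadicRectangle d)) := by
      intro K hK
      obtain ⟨x, hx, rfl, hconst⟩ := hmK K hK
      obtain ⟨Q, hQ, hPQ⟩ := hP (τ x) (cell (gridLevel σ (τ x)) x) (by simp [cell])
      exact ⟨Q, hQ, fun y hy => by simpa only [hconst y hy] using hPQ y hy⟩
    refine (iInf₂_le _ htmem).trans ?_
    have hptwise : ∀ᵐ x ∂cubeMeasure d, ‖s x - P (τ x) x‖ ≤
        ((fun x => ‖(s - P J) x‖) + ∑ i ∈ Finset.Ioc a J, fun x => ‖h i x‖) x := by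
      filter_upwards [ae_restrict_mem measurableSet_Icc] with x hx
      have hsplit : s x - P (τ x) x = (s - P J) x + ∑ i ∈ Finset.Ioc (τ x) J, h i x := by
        have h1 : ∑ i ∈ Finset.Ioc (τ x) J, h i x = P J x - P (τ x) x := by
          rw [sub_eq_sum_Ioc (fun i => P i x) (hτ x hx).2]
          refine Finset.sum_congr rfl fun i hi => ?_
          rw [Finset.mem_Ioc] at hi
          exact heq i x hx (hτΛ x hx i hi.1 hi.2)
        rw [h1, Pi.sub_apply]
        ring
      rw [hsplit, Pi.add_apply, Finset.sum_apply]
      refine (norm_add_le _ _).trans (add_le_add le_rfl ((norm_sum_le _ _).trans ?_))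
      exact Finset.sum_le_sum_of_subset_of_nonneg (Finset.Ioc_subset_Ioc_left (hτ x hx).1)
        fun i _ _ => norm_nonneg _
    refine (eLpNorm_mono_ae_real hptwise).trans ?_
    refine (eLpNorm_add_le (hs.sub (hPm J)).norm
      (Finset.aestronglyMeasurable_sum _ fun i _ => (hm i).norm) hq).trans ?_
    refine (add_le_add ((eLpNorm_norm _).trans_le htail)
      ((eLpNorm_sum_le (fun i _ => (hm i).norm) hq).trans
        (Finset.sum_le_sum fun i _ => (eLpNorm_norm _).trans_le (hle i)))).trans ?_
    rw [← ENNReal.ofReal_sum_of_nonneg fun i _ => by positivity,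
      ← ENNReal.ofReal_add (by positivity) (Finset.sum_nonneg fun i _ => by positivity)]
    refine ENNReal.ofReal_le_ofReal ?_
    have hkH : 0 < (2 : ℝ) ^ (-((k : ℝ) * harmonicMean σ)) := by positivity
    have hJρ : 0 < (2 : ℝ) ^ (-((J : ℝ) * ρ)) := by positivity
    have hsumB : ∑ i ∈ Finset.Ioc a J, (C / (c * 2 ^ (k * d) * ((2 : ℝ) ^ (-δ)) ^ (i - a))) ^ γ *
        (G * R) * (2 : ℝ) ^ (-((i : ℝ) * ρ)) ≤
          D2 * R * (2 : ℝ) ^ (-((k : ℝ) * harmonicMean σ)) := by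
      by_cases haJ' : a = J
      · rw [haJ', Finset.Ioc_self, Finset.sum_empty]
        positivity
      have hterm : ∀ i ∈ Finset.Ioc a J,
          (C / (c * 2 ^ (k * d) * ((2 : ℝ) ^ (-δ)) ^ (i - a))) ^ γ * (G * R) *
            (2 : ℝ) ^ (-((i : ℝ) * ρ)) =
          (C / c) ^ γ * (G * R) * ((2 : ℝ) ^ (-(k * d * γ)) * (2 : ℝ) ^ (-((a : ℝ) * ρ))) *
            ((2 : ℝ) ^ (-(ρ / 2))) ^ (i - a) := by
        intro i hi
        have e1 : C / (c * 2 ^ (k * d) * ((2 : ℝ) ^ (-δ)) ^ (i - a)) =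
            C / c * ((2 : ℝ) ^ (-(k * d : ℝ)) * (2 : ℝ) ^ (δ * (i - a : ℕ))) := by
          rw [← Real.rpow_natCast (2 : ℝ) (k * d), ← Real.rpow_natCast _ (i - a),
            ← Real.rpow_mul zero_le_two, Real.rpow_neg zero_le_two, neg_mul,
            Real.rpow_neg zero_le_two]
          push_cast
          field_simp
        have e2 : δ * ((i - a : ℕ) : ℝ) * γ + -(ρ * ((i - a : ℕ) : ℝ)) =
            -(ρ / 2) * ((i - a : ℕ) : ℝ) := by
          rw [hδ]
          field_simp
          ring
        rw [e1, Real.mul_rpow (by positivity) (by positivity),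
          Real.mul_rpow (by positivity) (by positivity), ← Real.rpow_mul zero_le_two,
          ← Real.rpow_mul zero_le_two, two_rpow_neg_eq_mul_pow (Finset.mem_Ioc.1 hi).1.le ρ,
          ← Real.rpow_natCast ((2 : ℝ) ^ (-(ρ / 2))), ← Real.rpow_natCast ((2 : ℝ) ^ (-ρ)),
          ← Real.rpow_mul zero_le_two, ← Real.rpow_mul zero_le_two, ← e2,
          Real.rpow_add two_pos, neg_mul, neg_mul]
        ring
      rw [Finset.sum_congr rfl hterm, ← Finset.mul_sum]
      have hstart := two_rpow_start_le hρ0.le haJ'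
      have hexp : (2 : ℝ) ^ (-(k * d * γ)) *
          (2 : ℝ) ^ (-((k * d : ℝ) / (sigmaMin σ * ∑ l, 1 / σ l) * ρ)) =
            (2 : ℝ) ^ (-((k : ℝ) * harmonicMean σ)) := by
        rw [← Real.rpow_add two_pos]
        congr 1
        rw [hρ, harmonicMean_eq]
        field_simp
        ring
      calc (C / c) ^ γ * (G * R) * ((2 : ℝ) ^ (-(k * d * γ)) * (2 : ℝ) ^ (-((a : ℝ) * ρ))) *
            ∑ i ∈ Finset.Ioc a J, ((2 : ℝ) ^ (-(ρ / 2))) ^ (i - a)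
          ≤ (C / c) ^ γ * (G * R) * ((2 : ℝ) ^ (-(k * d * γ)) * ((2 : ℝ) ^ ρ *
              (2 : ℝ) ^ (-((k * d : ℝ) / (sigmaMin σ * ∑ l, 1 / σ l) * ρ)))) * T2 := by
            gcongr
            exact sum_Ioc_le_tsum hsum2 (fun u => by positivity) a J
        _ = D2 * R * ((2 : ℝ) ^ (-(k * d * γ)) *
              (2 : ℝ) ^ (-((k * d : ℝ) / (sigmaMin σ * ∑ l, 1 / σ l) * ρ))) := by
            rw [hD2]; ring
        _ = _ := by rw [hexp]
    calc _ ≤ D1 * R * (2 : ℝ) ^ (-((J : ℝ) * ρ)) +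
          D2 * R * (2 : ℝ) ^ (-((k : ℝ) * harmonicMean σ)) := add_le_add le_rfl hsumB
      _ ≤ (D1 + D2 + 1) * R * (2 : ℝ) ^ (-((J : ℝ) * ρ)) +
          (D1 + D2 + 1) * R * (2 : ℝ) ^ (-((k : ℝ) * harmonicMean σ)) := by
        gcongr <;> linarith
      _ = _ := by ring

end AnisotropicApprox

theorem mainTheorem4 (d : ℕ) (hd : 0 < d) (σ : Fin d → ℝ) (hσ : ∀ l, 0 < σ l)
    (p : ℝ≥0∞) (hp0 : 0 < p) (hp : p < ∞) :
    ∃ C₁ : ℝ, 0 < C₁ ∧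
      ∀ (r : Fin d → ℕ) (q : ℝ≥0∞), (∀ l, σ l < r l + 1) → 1 ≤ q →
        AnisotropicApprox.invGap p q < AnisotropicApprox.harmonicMean σ / d →
        ∃ C₃ : ℝ, 0 < C₃ ∧
          ∀ (J : ℕ) (R : ℝ) (p' : ℝ≥0∞), 0 < R →
            (p ≤ 1 ∨ q ≤ p → p' = ∞) → (1 < p ∧ p < q → p' = p) →
            ∀ s ∈ AnisotropicApprox.smoothnessClass r σ p p' R, ∀ k : ℕ,
              ∃ m : Finset (AnisotropicApprox.DyadicRectangle d),
                AnisotropicApprox.IsDyadicPartition m ∧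
                (∀ K ∈ m, ∀ l,
                  (2 : ℝ) ^ (-((J : ℝ) * AnisotropicApprox.sigmaMin σ / σ l))
                    ≤ K.sidelength l) ∧
                (m.card : ℝ) ≤ C₁ * 2 ^ (k * d) ∧
                AnisotropicApprox.approxError q
                    (AnisotropicApprox.piecewisePoly r (m : Set _)) s
                  ≤ ENNReal.ofReal (C₃ * R *
                      ((2 : ℝ) ^ (-((J : ℝ) * d *
                          (AnisotropicApprox.harmonicMean σ / d
                            - AnisotropicApprox.invGap p q) *
                          AnisotropicApprox.sigmaMin σ / AnisotropicApprox.harmonicMean σ))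
                        + (2 : ℝ) ^ (-((k : ℝ) * AnisotropicApprox.harmonicMean σ)))) := by
  open AnisotropicApprox in
  have hσ0 := sigmaMin_pos hd hσ
  have hS0 := sum_inv_pos hd hσ
  have hd0 : (0 : ℝ) < d := by exact_mod_cast hd
  have hexp : ∀ (J : ℕ) (γ : ℝ), (J : ℝ) * d * (harmonicMean σ / d - γ) * sigmaMin σ /
      harmonicMean σ = J * (sigmaMin σ - sigmaMin σ * (∑ l, 1 / σ l) * γ) := by
    intro J γ
    rw [harmonicMean_eq]
    field_simp
  -- All that matters about `p'` is that it is not `0`: the norm then bounds each weighted error.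
  have hp' : ∀ {p' q : ℝ≥0∞}, (p ≤ 1 ∨ q ≤ p → p' = ∞) → (1 < p ∧ p < q → p' = p) →
      p' ≠ 0 := by
    intro p' q h1 h2
    by_cases h : p ≤ 1 ∨ q ≤ p
    · simp [h1 h]
    · rw [h2 ⟨not_le.1 fun h' => h (Or.inl h'), not_le.1 fun h' => h (Or.inr h')⟩]
      exact hp0.ne'
  refine ⟨1 + 2 ^ d, by positivity, fun r q _ hq hgap => ?_⟩
  rcases le_or_gt q p with hqp | hpq
  · have hgap0 : invGap p q = 0 := by
      refine max_eq_right (sub_nonpos.2 ?_)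
      exact ENNReal.toReal_mono (ENNReal.inv_ne_top.2 (zero_lt_one.trans_le hq).ne')
        (ENNReal.inv_le_inv.2 hqp)
    refine ⟨2 * (2 : ℝ) ^ sigmaMin σ, by positivity, fun J R p' hR h1 h2 s hs k => ?_⟩
    obtain ⟨P, hP⟩ := exists_approx_sequence hR (hp' h1 h2) hs
    obtain ⟨m, hm, hlev, hcard, herr⟩ := exists_linear_approx hd hσ hqp hR
      hs.1.aestronglyMeasurable (fun k => (hP k).1) (fun k => (hP k).2) J k
    refine ⟨m, hm, fun K hK l => ?_, hcard.trans ?_, herr.trans (le_of_eq ?_)⟩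
    · obtain ⟨j, hj, hKj⟩ := hlev K hK
      exact le_sidelength_of_level_eq hd hσ hj hKj l
    · exact le_mul_of_one_le_left (by positivity) (le_add_of_nonneg_right (by positivity))
    · rw [hexp, hgap0, mul_zero, sub_zero]
  · have hlt : 0 < p⁻¹.toReal - q⁻¹.toReal := sub_pos.2
      ((ENNReal.toReal_lt_toReal (ENNReal.inv_ne_top.2 (hp0.trans hpq).ne')
        (ENNReal.inv_ne_top.2 hp0.ne')).2 (ENNReal.inv_lt_inv.2 hpq))
    have hgap0 : invGap p q = p⁻¹.toReal - q⁻¹.toReal := max_eq_left hlt.le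
    have hρ0 : 0 < sigmaMin σ - sigmaMin σ * (∑ l, 1 / σ l) * invGap p q := by
      rw [harmonicMean_eq, div_div, mul_comm, ← div_div, div_self hd0.ne', lt_div_iff₀ hS0] at hgap
      nlinarith
    obtain ⟨C₃, hC₃, H⟩ := exists_adaptive_approx hd hσ r hp0 hpq hq
      (by rw [hgap0, ENNReal.toReal_inv, ENNReal.toReal_inv]) (hgap0 ▸ hlt) rfl hρ0
    refine ⟨C₃, hC₃, fun J R p' hR h1 h2 s hs k => ?_⟩
    obtain ⟨P, hP⟩ := exists_approx_sequence hR (hp' h1 h2) hs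
    obtain ⟨m, hm, hlev, hcard, herr⟩ := H R hR s hs.1.aestronglyMeasurable P
      (fun k => (hP k).1) (fun k => (hP k).2) J k
    refine ⟨m, hm, fun K hK l => ?_, hcard, herr.trans (le_of_eq ?_)⟩
    · obtain ⟨j, hj, hKj⟩ := hlev K hK
      exact le_sidelength_of_level_eq hd hσ hj hKj l
    · rw [hexp]
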